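/- **Theorem (Provability Preservation).** Let $\mathcal L$ be the set of modal formulas built from atoms $p_0,p_1,\dots$ with $\wedge,\vee,\to,\top,\bot,\Box,\Diamond$. Let $\mathcal L^+$ be the set of formulas in the language obtained by adding, for every $\varphi\in\mathcal L$, a fresh atom $\langle\varphi\rangle$, called an *angled atom*. *Basic* formulas are built from atoms, $\top$, $\bot$ by $\wedge,\vee,\Diamond$. *Almost positive* formulas form the smallest class that contains the basic formulas and is closed under $\wedge,\vee,\Box,\Diamond$ and under $A\to B$ with $A$ basic and $B$ almost positive. *Constructive* formulas form the smallest class that contains the basic formulas and is closed under $\wedge,\Box$ and under $A\to B$ with $A$ almost positive and $B$ constructive. *Modal Horn* formulas form the smallest class of $\mathcal L^+$-formulas that contains $\bot$ and all atoms and is closed under $\Box$ and under $\bigl(\bigwedge_{i=1}^k\Diamond^{n_i}q_i\bigr)\to B$ with $k\ge 1$, $n_i\ge 0$, $q_i$ atoms and $B$ modal Horn. The translation $t:\mathcal L\to\mathcal L^+$ is given by $\bot^t=\bot$, $\top^t=\langle\top\rangle$, $p^t=\langle p\rangle$ for atoms $p$, $(A\circ B)^t=(A^t\circ B^t)\wedge\langle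 A\circ B\rangle$ for $\circ\in\{\wedge,\vee,\to\}$, and $(\bigcirc A)^t=(\bigcirc A^t)\wedge\langle\bigcirc A\rangle$ for $\bigcirc\in\{\Box,\Diamond\}$. The standard substitution $s:\mathcal L^+\to\mathcal L$ replaces each angled atom $\langle\varphi\rangle$ by $\varphi$ and leaves everything else unchanged. Both are applied elementwise to multisets, and $\bigwedge\varnothing=\top$. Sequents $\Omega\Rightarrow\Lambda$ consist of finite multisets of formulas, where $\Lambda$ has at most one element. The calculus $\mathbf{CK}$ is Gentzen's single-conclusion sequent calculus $\mathbf{LJ}$ for intuitionistic logic (axioms $\Gamma,A\Rightarrow A$, $\ \Gamma,\bot\Rightarrow\Delta$, $\ \Gamma\Rightarrow\top$; weakening, left contraction, cut, and the left and right rules for $\wedge,\vee,\to$, all premises of a rule sharing the same context) together with the rules $$\frac{\Gamma\Rightarrow A}{\Box\Gamma\Rightarrow\Box A}\ (K_\Box)\qquad\frac{\Gamma,A\Rightarrow B}{\Box\Gamma,\Diamond A\Rightarrow\Diamond B}\ (K_\Diamond).$$ For a set $\mathcal C\subseteq\mathcal L$, the calculus $\mathbf{CK}+\mathcal C$ has in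 addition the axioms $(\Rightarrow C(\overline\varphi))$ for all $C(\overline p)\in\mathcal C$ and all formulas $\overline\varphi$ substituted for its atoms; it is used over $\mathcal L$ and, with the same rules, over $\mathcal L^+$. Proofs are tree-like. Let $G=\mathbf{CK}+\mathcal C$, where $\mathcal C$ is a finite set of constructive formulas. Then there is an algorithm, running in time polynomial in the size of its input, that reads a $G$-proof $\pi$ over $\mathcal L$ of a sequent $\Omega\Rightarrow\Lambda$ and outputs a finite multiset $\Sigma_\pi$ of $\mathcal L^+$-formulas and a $G$-proof $\sigma_\pi$ over $\mathcal L$ such that 1. $G\vdash\Sigma_\pi,\Omega^t\Rightarrow\Lambda^t$ (over $\mathcal L^+$); 2. every formula in $\Sigma_\pi$ is a modal Horn formula constructed from angled atoms only; 3. $\sigma_\pi$ is a $G$-proof of $(\Rightarrow\bigwedge\Sigma_\pi^s)$. -/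

import Mathlib

namespace ModalHornTranslation

/-! ### Formulas -/

/-- Formulas of the language `{∧, ∨, →, ⊤, ⊥, □, ◇}` over the atoms `α`. -/
inductive Fm (α : Type) : Type
  | atom (a : α) : Fm α
  | bot : Fm α
  | top : Fm α
  | and (A B : Fm α) : Fm α
  | or (A B : Fm α) : Fm α
  | imp (A B : Fm α) : Fm α
  | box (A : Fm α) : Fm α
  | dia (A : Fm α) : Fm α

namespace Fm

variable {α β : Type}

/-- Simultaneous substitution of formulas for atoms. -/
def subst (v : α → Fm β) : Fm α → Fm β
  | atom a => v a
  | bot => bot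
  | top => top
  | and A B => and (A.subst v) (B.subst v)
  | or A B => or (A.subst v) (B.subst v)
  | imp A B => imp (A.subst v) (B.subst v)
  | box A => box (A.subst v)
  | dia A => dia (A.subst v)

/-- `γ₁ ∧ (γ₂ ∧ (⋯ ∧ γₙ))`; the empty conjunction is `⊤`, the conjunction of one formula is
that formula. -/
def conj : List (Fm α) → Fm α
  | [] => top
  | [A] => A
  | A :: B :: L => and A (conj (B :: L))

/-- Basic formulas. -/
inductive Basic : Fm α → Prop
  | atom (a : α) : Basic (atom a)
  | bot : Basic bot
  | top : Basic top
  | and {A B : Fm α} : Basic A → Basic B → Basic (and A B)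
  | or {A B : Fm α} : Basic A → Basic B → Basic (or A B)
  | dia {A : Fm α} : Basic A → Basic (dia A)

/-- Almost positive formulas. -/
inductive AlmostPositive : Fm α → Prop
  | basic {A : Fm α} : Basic A → AlmostPositive A
  | and {A B : Fm α} : AlmostPositive A → AlmostPositive B → AlmostPositive (and A B)
  | or {A B : Fm α} : AlmostPositive A → AlmostPositive B → AlmostPositive (or A B)
  | box {A : Fm α} : AlmostPositive A → AlmostPositive (box A)
  | dia {A : Fm α} : AlmostPositive A → AlmostPositive (dia A)
  | imp {A B : Fm α} : Basic A → AlmostPositive B → AlmostPositive (imp A B)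

/-- Constructive formulas. -/
inductive Constructive : Fm α → Prop
  | basic {A : Fm α} : Basic A → Constructive A
  | and {A B : Fm α} : Constructive A → Constructive B → Constructive (and A B)
  | box {A : Fm α} : Constructive A → Constructive (box A)
  | imp {A B : Fm α} : AlmostPositive A → Constructive B → Constructive (imp A B)

/-- Modal Horn formulas: `⊥`, the atoms, and the closure under `□` and under implications
`(◇^{n₁} p₁ ∧ ⋯ ∧ ◇^{nₖ} pₖ) → B` with `k ≥ 1`, atoms `pᵢ` and `B` modal Horn. -/
inductive ModalHorn : Fm α → Prop
  | bot : ModalHorn bot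
  | atom (a : α) : ModalHorn (atom a)
  | box {A : Fm α} : ModalHorn A → ModalHorn (box A)
  | imp (L : List (ℕ × α)) {B : Fm α} : L ≠ [] → ModalHorn B →
      ModalHorn (imp (conj (L.map fun q => dia^[q.1] (atom q.2))) B)

end Fm

/-- The formulas of `𝓛`; the atoms are indexed by `ℕ`. -/
abbrev FmL : Type := Fm ℕ

/-- The formulas of `𝓛⁺`: the atoms are those of `𝓛` together with one new atom `⟨φ⟩` for every
formula `φ` of `𝓛`. -/
abbrev FmPlus : Type := Fm (ℕ ⊕ FmL)

/-- The angled atom `⟨φ⟩`. -/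
def angled (φ : FmL) : FmPlus := Fm.atom (Sum.inr φ)

/-- The transation `t : 𝓛 → 𝓛⁺`. -/
def transl : FmL → FmPlus
  | .atom p => angled (.atom p)
  | .bot => .bot
  | .top => angled .top
  | .and A B => .and (.and (transl A) (transl B)) (angled (.and A B))
  | .or A B => .and (.or (transl A) (transl B)) (angled (.or A B))
  | .imp A B => .and (.imp (transl A) (transl B)) (angled (.imp A B))
  | .box A => .and (.box (transl A)) (angled (.box A))
  | .dia A => .and (.dia (transl A)) (angled (.dia A))

/-- The standard substitution `s : 𝓛⁺ → 𝓛`. -/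
def stdSubst : FmPlus → FmL :=
  Fm.subst (Sum.elim Fm.atom id)

/-- The formula is built from angled atoms only: every leaf of it is an angled atom, so neither an
atom of `𝓛` nor a constant `⊥`, `⊤` occurs. -/
def FromAngledAtoms : FmPlus → Prop
  | .atom (.inl _) => False
  | .atom (.inr _) => True
  | .bot => False
  | .top => False
  | .and A B => FromAngledAtoms A ∧ FromAngledAtoms B
  | .or A B => FromAngledAtoms A ∧ FromAngledAtoms B
  | .imp A B => FromAngledAtoms A ∧ FromAngledAtoms B
  | .box A => FromAngledAtoms A
  | .dia A => FromAngledAtoms A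

/-! ### The calculus `CK + 𝓒` -/

/-- Single-conclusion sequents `Γ ⇒ Δ`, where `Γ` is a finite multiset and `Δ` has at most one
formula. -/
structure Sequent (α : Type) where
  ant : Multiset (Fm α)
  suc : Option (Fm α)

/-- Instances of the axioms of `CK + 𝓒` over the atoms `α`. -/
inductive IsAxiom {α : Type} (C : Set FmL) : Sequent α → Prop
  | id (Γ : Multiset (Fm α)) (A : Fm α) : IsAxiom C ⟨A ::ₘ Γ, some A⟩
  | botL (Γ : Multiset (Fm α)) (Δ : Option (Fm α)) : IsAxiom C ⟨Fm.bot ::ₘ Γ, Δ⟩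
  | topR (Γ : Multiset (Fm α)) : IsAxiom C ⟨Γ, some Fm.top⟩
  | ofMem (A : FmL) (hA : A ∈ C) (v : ℕ → Fm α) : IsAxiom C ⟨0, some (A.subst v)⟩

/-- Instances of the rules of `CK` with one premise: `Rule₁ premise conclusion`. -/
inductive Rule₁ {α : Type} : Sequent α → Sequent α → Prop
  | weakL (Γ : Multiset (Fm α)) (Δ : Option (Fm α)) (A : Fm α) : Rule₁ ⟨Γ, Δ⟩ ⟨A ::ₘ Γ, Δ⟩
  | weakR (Γ : Multiset (Fm α)) (A : Fm α) : Rule₁ ⟨Γ, none⟩ ⟨Γ, some A⟩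
  | contrL (Γ : Multiset (Fm α)) (Δ : Option (Fm α)) (A : Fm α) :
      Rule₁ ⟨A ::ₘ A ::ₘ Γ, Δ⟩ ⟨A ::ₘ Γ, Δ⟩
  | andL₁ (Γ : Multiset (Fm α)) (Δ : Option (Fm α)) (A B : Fm α) :
      Rule₁ ⟨A ::ₘ Γ, Δ⟩ ⟨Fm.and A B ::ₘ Γ, Δ⟩
  | andL₂ (Γ : Multiset (Fm α)) (Δ : Option (Fm α)) (A B : Fm α) :
      Rule₁ ⟨B ::ₘ Γ, Δ⟩ ⟨Fm.and A B ::ₘ Γ, Δ⟩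
  | orR₁ (Γ : Multiset (Fm α)) (A B : Fm α) : Rule₁ ⟨Γ, some A⟩ ⟨Γ, some (Fm.or A B)⟩
  | orR₂ (Γ : Multiset (Fm α)) (A B : Fm α) : Rule₁ ⟨Γ, some B⟩ ⟨Γ, some (Fm.or A B)⟩
  | impR (Γ : Multiset (Fm α)) (A B : Fm α) :
      Rule₁ ⟨A ::ₘ Γ, some B⟩ ⟨Γ, some (Fm.imp A B)⟩
  | kBox (Γ : Multiset (Fm α)) (A : Fm α) :
      Rule₁ ⟨Γ, some A⟩ ⟨Γ.map Fm.box, some (Fm.box A)⟩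
  | kDia (Γ : Multiset (Fm α)) (A B : Fm α) :
      Rule₁ ⟨A ::ₘ Γ, some B⟩ ⟨Fm.dia A ::ₘ Γ.map Fm.box, some (Fm.dia B)⟩

/-- Instances of the rules of `CK` with two premises: `Rule₂ premise premise conclusion`. -/
inductive Rule₂ {α : Type} : Sequent α → Sequent α → Sequent α → Prop
  | cut (Γ : Multiset (Fm α)) (Δ : Option (Fm α)) (A : Fm α) :
      Rule₂ ⟨Γ, some A⟩ ⟨A ::ₘ Γ, Δ⟩ ⟨Γ, Δ⟩
  | andR (Γ : Multiset (Fm α)) (A B : Fm α) :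
      Rule₂ ⟨Γ, some A⟩ ⟨Γ, some B⟩ ⟨Γ, some (Fm.and A B)⟩
  | orL (Γ : Multiset (Fm α)) (Δ : Option (Fm α)) (A B : Fm α) :
      Rule₂ ⟨A ::ₘ Γ, Δ⟩ ⟨B ::ₘ Γ, Δ⟩ ⟨Fm.or A B ::ₘ Γ, Δ⟩
  | impL (Γ : Multiset (Fm α)) (Δ : Option (Fm α)) (A B : Fm α) :
      Rule₂ ⟨Γ, some A⟩ ⟨B ::ₘ Γ, Δ⟩ ⟨Fm.imp A B ::ₘ Γ, Δ⟩

/-- A sequent as it is written down: the antecedent is listed in some order. -/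
structure Line (α : Type) where
  ant : List (Fm α)
  suc : Option (Fm α)

/-- The sequent that a line denotes. -/
def Line.toSequent {α : Type} (S : Line α) : Sequent α := ⟨(S.ant : Multiset (Fm α)), S.suc⟩

/-- Trees of written sequents in which every node has at most two immediate subtrees. Only the
sequents are recorded, not the rules. -/
inductive ProofTree (α : Type) : Type
  | leaf (S : Line α) : ProofTree α
  | unary (S : Line α) (π : ProofTree α) : ProofTree α
  | binary (S : Line α) (π₁ π₂ : ProofTree α) : ProofTree α

namespace ProofTree

variable {α : Type}

/-- The written sequent at the root. -/
def root : ProofTree α → Line α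
  | leaf S => S
  | unary S _ => S
  | binary S _ _ => S

/-- The end-sequent. -/
def concl (π : ProofTree α) : Sequent α := π.root.toSequent

/-- The tree is a (tree-like) proof in `CK + 𝓒`. -/
def IsProof (C : Set FmL) : ProofTree α → Prop
  | leaf S => IsAxiom C S.toSequent
  | unary S π => π.IsProof C ∧ Rule₁ π.concl S.toSequent
  | binary S π₁ π₂ => π₁.IsProof C ∧ π₂.IsProof C ∧ Rule₂ π₁.concl π₂.concl S.toSequent

end ProofTree

/-- `CK + 𝓒 ⊢ S`, for sequents over the atoms `α`. -/
def Provable {α : Type} (C : Set FmL) (S : Sequent α) : Prop :=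
  ∃ π : ProofTree α, π.IsProof C ∧ π.concl = S

/-- The proofs in `CK + 𝓒` over the language `𝓛`. -/
abbrev GProof (C : Set FmL) : Type := {π : ProofTree ℕ // π.IsProof C}

/-! ### Writing formulas, multisets and proofs as strings

Every object is first written as a binary tree and the tree as a bit string in Polish notation.
Natural numbers (the indices of the atoms) are written in binary, and the length of a string is
linear in the number of symbols of the object it describes, where the binary digits of the index of an
atom count as symbols. -/

/-- Binary trees. -/
inductive SExp : Type
  | nil : SExp
  | cons (a b : SExp) : SExp

namespace SExp

/-- The bit string of a binary tree, in Polish notation. -/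
def toBits : SExp → List Bool
  | nil => [false]
  | cons a b => true :: (a.toBits ++ b.toBits)

/-- Numerals used as tags for the constructors. -/
def tag : ℕ → SExp
  | 0 => nil
  | n + 1 => cons nil (tag n)

end SExp

open SExp in
/-- Lists. -/
def codeList {β : Type} (c : β → SExp) : List β → SExp
  | [] => nil
  | b :: L => cons (c b) (codeList c L)

open SExp in
/-- Optional objects. -/
def codeOption {β : Type} (c : β → SExp) : Option β → SExp
  | none => nil
  | some b => cons nil (c b)

open SExp in
/-- Natural numbers, in binary. -/
def codeNat (n : ℕ) : SExp :=
  codeList (fun b : Bool => if b then cons nil nil else nil) (Computability.encodeNat n)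

open SExp in
/-- Formulas. -/
def codeFm {α : Type} (c : α → SExp) : Fm α → SExp
  | .atom a => cons (tag 0) (c a)
  | .bot => cons (tag 1) nil
  | .top => cons (tag 2) nil
  | .and A B => cons (tag 3) (cons (codeFm c A) (codeFm c B))
  | .or A B => cons (tag 4) (cons (codeFm c A) (codeFm c B))
  | .imp A B => cons (tag 5) (cons (codeFm c A) (codeFm c B))
  | .box A => cons (tag 6) (codeFm c A)
  | .dia A => cons (tag 7) (codeFm c A)

open SExp in
/-- Atoms of `𝓛⁺`; the angled atom `⟨φ⟩` is written with all the symbols of `φ`. -/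
def codeAtomPlus : ℕ ⊕ FmL → SExp
  | .inl n => cons (tag 0) (codeNat n)
  | .inr φ => cons (tag 1) (codeFm codeNat φ)

open SExp in
/-- Written sequents. -/
def codeLine {α : Type} (c : α → SExp) (S : Line α) : SExp :=
  cons (codeList (codeFm c) S.ant) (codeOption (codeFm c) S.suc)

open SExp in
/-- Proof trees. -/
def codeTree {α : Type} (c : α → SExp) : ProofTree α → SExp
  | .leaf S => cons (tag 0) (codeLine c S)
  | .unary S π => cons (tag 1) (cons (codeLine c S) (codeTree c π))
  | .binary S π₁ π₂ =>
      cons (tag 2) (cons (codeLine c S) (cons (codeTree c π₁) (codeTree c π₂)))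

/-- The input string: a proof over `𝓛`. -/
def encodeProof {C : Set FmL} (π : GProof C) : List Bool :=
  (codeTree codeNat π.1).toBits

/-- The output string: a multiset of `𝓛⁺`-formulas, listed in some order, and a proof tree over
`𝓛`. -/
def encodeOutput (o : List FmPlus × ProofTree ℕ) : List Bool :=
  (SExp.cons (codeList (codeFm codeAtomPlus) o.1) (codeTree codeNat o.2)).toBits

/-! The strings determine the objects. -/

theorem SExp.toBits_append_inj : ∀ (a b : SExp) (u v : List Bool),
    a.toBits ++ u = b.toBits ++ v → a = b ∧ u = v
  | .nil, .nil, u, v, h => by simpa [SExp.toBits] using h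
  | .nil, .cons _ _, u, v, h => by simp [SExp.toBits] at h
  | .cons _ _, .nil, u, v, h => by simp [SExp.toBits] at h
  | .cons a₁ a₂, .cons b₁ b₂, u, v, h => by
      simp only [SExp.toBits, List.cons_append, List.append_assoc, List.cons.injEq,
        true_and] at h
      obtain ⟨h₁, h⟩ := SExp.toBits_append_inj a₁ b₁ _ _ h
      obtain ⟨h₂, h⟩ := SExp.toBits_append_inj a₂ b₂ _ _ h
      exact ⟨by rw [h₁, h₂], h⟩

theorem SExp.toBits_injective : Function.Injective SExp.toBits := fun a b h =>
  (SExp.toBits_append_inj a b [] [] (by simpa using h)).1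

theorem codeList_injective {β : Type} {c : β → SExp} (hc : Function.Injective c) :
    Function.Injective (codeList c)
  | [], [], _ => rfl
  | [], _ :: _, h => by simp [codeList] at h
  | _ :: _, [], h => by simp [codeList] at h
  | a :: L, b :: M, h => by
      simp only [codeList, SExp.cons.injEq] at h
      rw [hc h.1, codeList_injective hc h.2]

theorem codeOption_injective {β : Type} {c : β → SExp} (hc : Function.Injective c) :
    Function.Injective (codeOption c) := by
  intro a b h
  cases a <;> cases b <;> simp [codeOption] at h ⊢
  exact hc h

theorem codeNat_injective : Function.Injective codeNat := by
  intro m n h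
  have h' := codeList_injective (by intro a b; cases a <;> cases b <;> simp) h
  rw [← Computability.decode_encodeNat m, ← Computability.decode_encodeNat n, h']

theorem codeFm_injective {α : Type} {c : α → SExp} (hc : Function.Injective c) :
    Function.Injective (codeFm c) := by
  intro A
  induction A <;> intro B h <;> cases B <;> simp [codeFm, SExp.tag] at h ⊢
  case atom.atom => exact hc h
  case and.and ih₁ ih₂ _ _ => exact ⟨ih₁ h.1, ih₂ h.2⟩
  case or.or ih₁ ih₂ _ _ => exact ⟨ih₁ h.1, ih₂ h.2⟩
  case imp.imp ih₁ ih₂ _ _ => exact ⟨ih₁ h.1, ih₂ h.2⟩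
  case box.box ih _ => exact ih h
  case dia.dia ih _ => exact ih h

theorem codeAtomPlus_injective : Function.Injective codeAtomPlus := by
  intro a b h
  cases a <;> cases b <;> simp [codeAtomPlus, SExp.tag] at h ⊢
  · exact codeNat_injective h
  · exact codeFm_injective codeNat_injective h

theorem codeLine_injective {α : Type} {c : α → SExp} (hc : Function.Injective c) :
    Function.Injective (codeLine c) := by
  rintro ⟨Γ, Δ⟩ ⟨Γ', Δ'⟩ h
  simp only [codeLine, SExp.cons.injEq] at h
  rw [codeList_injective (codeFm_injective hc) h.1, codeOption_injective (codeFm_injective hc) h.2]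

theorem codeTree_injective {α : Type} {c : α → SExp} (hc : Function.Injective c) :
    Function.Injective (codeTree c) := by
  intro π
  induction π <;> intro ρ h <;> cases ρ <;> simp [codeTree, SExp.tag] at h ⊢
  case leaf.leaf => exact codeLine_injective hc h
  case unary.unary ih _ _ => exact ⟨codeLine_injective hc h.1, ih h.2⟩
  case binary.binary ih₁ ih₂ _ _ _ => exact ⟨codeLine_injective hc h.1, ih₁ h.2.1, ih₂ h.2.2⟩

theorem encodeProof_injective (C : Set FmL) :
    Function.Injective (encodeProof : GProof C → List Bool) := fun _ _ h =>
  Subtype.ext (codeTree_injective codeNat_injective (SExp.toBits_injective h))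

theorem encodeOutput_injective : Function.Injective encodeOutput := by
  intro o o' h
  have h' := SExp.toBits_injective h
  simp only [SExp.cons.injEq] at h'
  exact Prod.ext (codeList_injective (codeFm_injective codeAtomPlus_injective) h'.1)
    (codeTree_injective codeNat_injective h'.2)

end ModalHornTranslation

open ModalHornTranslation

/-! Why it holds. The proof `π` is replayed on translated formulas. A translated compound is the
compound of the translations together with an angled atom, so each rule application still yields the
structural conjunct of its succedent; only the angled conjunct `⟨D⟩` is missing. Each translated
antecedent entails its own angled atom (`Entails.angled`), so a node with sequent `γ₁, …, γₙ ⇒ D` is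
repaired by the curried Horn formula `⟨γₙ⟩ → ⋯ → ⟨γ₁⟩ → ⟨D⟩`. Its standard substitution is proved by
the subproof at that node followed by `n` right implications. Since the modal rules only see boxed
context, each such formula is supplied under `k` boxes for every `k` up to a bound on the number of
modal rules met on a branch (`holds_of_isProof`).

Axioms `A(φ)` with `A ∈ 𝓒` need more: `A(φᵗ)` is again an axiom, and finitely many Horn formulas
must lead from it to `A(φ)ᵗ`. They depend on `A` only, up to instantiation inside the angled atoms.
Three inductions produce them: from `A(φᵗ)` to `A(φ)ᵗ` for basic `A`, back again for almost positive
`A`, and forward for constructive `A`, where the Horn formulas only have to follow from `A` itself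
(`RelTranslFromSubst.ofConstructive`). As `A` is an axiom, they have fixed proofs, which are stored
as templates. The algorithm adds the instances of all templates, matched against the succedent, at
every node with a succedent, axiom or not: every instance is sound, so nothing has to be recognised.

For the running time, a small language of stack programs is compiled step by step to Turing
machines. The predicate `PolyTime` is closed under pairing, projections, case distinction and
iteration with polynomially bounded intermediate values (`PolyTime.iterate`). Loops count along the
code of the input, whose size bounds the number of nodes and the length of every antecedent. It
remains to bound the sizes of the loop states. -/

namespace ModalHornTranslation

/-! ### Stack programs -/

/-- Programs on registers that hold bit strings, used as stacks. -/
inductive Cmd : Type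
  | skip : Cmd
  | push (k : ℕ) (b : Bool) : Cmd
  | seq (c d : Cmd) : Cmd
  /-- Pop register `k` and branch: empty, `true`, `false`. -/
  | ifPop (k : ℕ) (e t f : Cmd) : Cmd
  /-- As long as register `k` is not empty, pop it and branch. -/
  | loop (k : ℕ) (t f : Cmd) : Cmd

namespace Cmd

/-- Contents of the registers. -/
abbrev Regs : Type := ℕ → List Bool

open Function (update)

/-- `Run c S n S'`: started on `S`, the program `c` stops after `n` steps on `S'`. -/
inductive Run : Cmd → Regs → ℕ → Regs → Prop
  | skip (S : Regs) : Run skip S 1 S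
  | push (k : ℕ) (b : Bool) (S : Regs) : Run (push k b) S 1 (update S k (b :: S k))
  | seq {c d : Cmd} {S S' S'' : Regs} {n m : ℕ} :
      Run c S n S' → Run d S' m S'' → Run (seq c d) S (n + m) S''
  | ifNil {k : ℕ} {e t f : Cmd} {S S' : Regs} {n : ℕ} :
      S k = [] → Run e S n S' → Run (ifPop k e t f) S (n + 1) S'
  | ifTrue {k : ℕ} {e t f : Cmd} {S S' : Regs} {n : ℕ} {l : List Bool} :
      S k = true :: l → Run t (update S k l) n S' → Run (ifPop k e t f) S (n + 1) S'
  | ifFalse {k : ℕ} {e t f : Cmd} {S S' : Regs} {n : ℕ} {l : List Bool} :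
      S k = false :: l → Run f (update S k l) n S' → Run (ifPop k e t f) S (n + 1) S'
  | loopTrue {k : ℕ} {t f : Cmd} {S S' S'' : Regs} {n m : ℕ} {l : List Bool} :
      S k = true :: l → Run t (update S k l) n S' → Run (loop k t f) S' m S'' →
      Run (loop k t f) S (n + m + 1) S''
  | loopFalse {k : ℕ} {t f : Cmd} {S S' S'' : Regs} {n m : ℕ} {l : List Bool} :
      S k = false :: l → Run f (update S k l) n S' → Run (loop k t f) S' m S'' →
      Run (loop k t f) S (n + m + 1) S''
  | loopNil {k : ℕ} {t f : Cmd} {S : Regs} : S k = [] → Run (loop k t f) S 1 S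

/-- All registers of the program are below `r`. -/
def Below (r : ℕ) : Cmd → Prop
  | skip => True
  | push k _ => k < r
  | seq c d => c.Below r ∧ d.Below r
  | ifPop k e t f => k < r ∧ e.Below r ∧ t.Below r ∧ f.Below r
  | loop k t f => k < r ∧ t.Below r ∧ f.Below r

theorem Below.mono {r s : ℕ} (h : r ≤ s) : ∀ {c : Cmd}, c.Below r → c.Below s
  | skip, _ => trivial
  | push _ _, hc => lt_of_lt_of_le hc h
  | seq _ _, hc => ⟨hc.1.mono h, hc.2.mono h⟩
  | ifPop _ _ _ _, hc =>
      ⟨lt_of_lt_of_le hc.1 h, hc.2.1.mono h, hc.2.2.1.mono h, hc.2.2.2.mono h⟩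
  | loop _ _ _, hc => ⟨lt_of_lt_of_le hc.1 h, hc.2.1.mono h, hc.2.2.mono h⟩

theorem exists_below (c : Cmd) : ∃ r, c.Below (r + 1) := by
  induction c with
  | skip => exact ⟨0, trivial⟩
  | push k b => exact ⟨k, Nat.lt_succ_self k⟩
  | seq c d ihc ihd =>
    obtain ⟨r, hr⟩ := ihc
    obtain ⟨s, hs⟩ := ihd
    exact ⟨max r s, hr.mono (by omega), hs.mono (by omega)⟩
  | ifPop k e t f ihe iht ihf =>
    obtain ⟨r, hr⟩ := ihe
    obtain ⟨s, hs⟩ := iht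
    obtain ⟨u, hu⟩ := ihf
    exact ⟨max k (max r (max s u)), show _ < _ by omega, hr.mono (by omega), hs.mono (by omega),
      hu.mono (by omega)⟩
  | loop k t f iht ihf =>
    obtain ⟨s, hs⟩ := iht
    obtain ⟨u, hu⟩ := ihf
    exact ⟨max k (max s u), show _ < _ by omega, hs.mono (by omega), hu.mono (by omega)⟩

/-! ### Compilation to Turing machines -/

/-- The labels of the machine code of a program. -/
def Label : Cmd → Type
  | skip => Unit
  | push _ _ => Unit
  | seq c d => c.Label ⊕ d.Label
  | ifPop _ e t f => Option (e.Label ⊕ t.Label ⊕ f.Label)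
  | loop _ t f => Option (t.Label ⊕ f.Label)

/-- There are finitely many labels. -/
@[reducible] noncomputable def labelFintype : (c : Cmd) → Fintype c.Label
  | skip => inferInstanceAs (Fintype Unit)
  | push _ _ => inferInstanceAs (Fintype Unit)
  | seq c d =>
      have := c.labelFintype
      have := d.labelFintype
      inferInstanceAs (Fintype (c.Label ⊕ d.Label))
  | ifPop _ e t f =>
      have := e.labelFintype
      have := t.labelFintype
      have := f.labelFintype
      inferInstanceAs (Fintype (Option (e.Label ⊕ t.Label ⊕ f.Label)))
  | loop _ t f =>
      have := t.labelFintype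
      have := f.labelFintype
      inferInstanceAs (Fintype (Option (t.Label ⊕ f.Label)))

/-- The label where the execution of a program starts. -/
def entry : (c : Cmd) → c.Label
  | skip => ()
  | push _ _ => ()
  | seq c _ => Sum.inl c.entry
  | ifPop _ _ _ _ => none
  | loop _ _ _ => none

/-- The registers below `r + 1` as stacks of a machine. -/
abbrev reg (r k : ℕ) : Fin (r + 1) := Fin.ofNat (r + 1) k

/-- Statements of a machine with `r + 1` stacks of bits, whose state is the result of the last
`pop`. -/
abbrev MStmt (r : ℕ) (Λ : Type) : Type :=
  Turing.TM2.Stmt (fun _ : Fin (r + 1) => Bool) Λ (Option Bool)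

open Turing.TM2.Stmt in
/-- Machine code of a program whose labels are embedded into `Λ`, and which continues at `exit`. -/
def code (r : ℕ) {Λ : Type} : (c : Cmd) → (c.Label → Λ) → Λ → c.Label → MStmt r Λ
  | skip, _, exit, _ => goto fun _ => exit
  | push k b, _, exit, _ => Turing.TM2.Stmt.push (reg r k) (fun _ => b) (goto fun _ => exit)
  | seq c d, emb, exit, l => match l with
    | Sum.inl l => c.code r (fun l => emb (Sum.inl l)) (emb (Sum.inr d.entry)) l
    | Sum.inr l => d.code r (fun l => emb (Sum.inr l)) exit l
  | ifPop k e t f, emb, exit, l => match l with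
    | none => pop (reg r k) (fun _ o => o) (goto fun o => match o with
      | none => emb (some (Sum.inl e.entry))
      | some true => emb (some (Sum.inr (Sum.inl t.entry)))
      | some false => emb (some (Sum.inr (Sum.inr f.entry))))
    | some (Sum.inl l) => e.code r (fun l => emb (some (Sum.inl l))) exit l
    | some (Sum.inr (Sum.inl l)) => t.code r (fun l => emb (some (Sum.inr (Sum.inl l)))) exit l
    | some (Sum.inr (Sum.inr l)) => f.code r (fun l => emb (some (Sum.inr (Sum.inr l)))) exit l
  | loop k t f, emb, exit, l => match l with
    | none => pop (reg r k) (fun _ o => o) (goto fun o => match o with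
      | none => exit
      | some true => emb (some (Sum.inl t.entry))
      | some false => emb (some (Sum.inr f.entry)))
    | some (Sum.inl l) => t.code r (fun l => emb (some (Sum.inl l))) (emb none) l
    | some (Sum.inr l) => f.code r (fun l => emb (some (Sum.inr l))) (emb none) l

/-- `n` steps of a machine. -/
def Steps {σ : Type} (f : σ → Option σ) (n : ℕ) (a b : σ) : Prop :=
  (flip bind f)^[n] (some a) = some b

theorem Steps.trans {σ : Type} {f : σ → Option σ} {n m : ℕ} {a b c : σ} (h : Steps f n a b)
    (h' : Steps f m b c) : Steps f (n + m) a c := by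
  unfold Steps at *
  rw [Nat.add_comm, Function.iterate_add_apply, h, h']

theorem Steps.one {σ : Type} {f : σ → Option σ} {a b : σ} (h : f a = some b) : Steps f 1 a b := h

/-- The stacks of a machine that hold the given registers. -/
def toStk (r : ℕ) (S : Regs) : Fin (r + 1) → List Bool := fun i => S i

theorem reg_val {r k : ℕ} (h : k < r + 1) : (reg r k : ℕ) = k := by
  simp [reg, Nat.mod_eq_of_lt h]

theorem toStk_update {r k : ℕ} (h : k < r + 1) (S : Regs) (x : List Bool) :
    update (toStk r S) (reg r k) x = toStk r (update S k x) := by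
  funext i
  by_cases hi : i = reg r k
  · subst hi
    simp [toStk, Nat.mod_eq_of_lt h]
  · have : (i : ℕ) ≠ k := fun e => hi (Fin.ext (by rw [reg_val h, e]))
    rw [Function.update_of_ne hi]
    simp [toStk, this]

theorem toStk_reg {r k : ℕ} (h : k < r + 1) (S : Regs) : toStk r S (reg r k) = S k := by
  simp [toStk, Nat.mod_eq_of_lt h]

theorem step_pop {r : ℕ} {Λ : Type} {M : Λ → MStmt r Λ} {l : Λ} {k : ℕ} {g : Option Bool → Λ}
    (hk : k < r + 1)
    (hM : M l = Turing.TM2.Stmt.pop (reg r k) (fun _ o => o) (Turing.TM2.Stmt.goto g))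
    (v : Option Bool) (S : Regs) :
    Turing.TM2.step M ⟨some l, v, toStk r S⟩ =
      some ⟨some (g (S k).head?), (S k).head?, toStk r (update S k (S k).tail)⟩ := by
  simp only [Turing.TM2.step, hM, Turing.TM2.stepAux]
  rw [toStk_update hk, toStk_reg hk]

/-- Only the embedded labels have to carry the code of `c`, so the induction applies to subprograms
inside a larger machine; the body of a loop exits to the label of the loop test. The state `v` is
arbitrary because a popped bit is consumed at once by the jump that follows. Step counts agree
exactly. -/
theorem Run.steps {r : ℕ} {Λ : Type} (M : Λ → MStmt r Λ) {c : Cmd} {S S' : Regs} {n : ℕ}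
    (h : Run c S n S') (hc : c.Below (r + 1)) (emb : c.Label → Λ) (exit : Λ)
    (hM : ∀ l, M (emb l) = c.code r emb exit l) (v : Option Bool) :
    ∃ v', Steps (Turing.TM2.step M) n ⟨some (emb c.entry), v, toStk r S⟩
      ⟨some exit, v', toStk r S'⟩ := by
  induction h generalizing exit v with
  | skip S => exact ⟨v, Steps.one (by simp [Turing.TM2.step, hM, code, Turing.TM2.stepAux])⟩
  | push k b S =>
    exact ⟨v, Steps.one (by
      simp [Turing.TM2.step, hM, code, Turing.TM2.stepAux, toStk_update hc, toStk_reg hc,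
        -Fin.ofNat_eq_cast])⟩
  | @seq c d S S' S'' n m _ _ ih ih' =>
    obtain ⟨v₁, h₁⟩ := ih hc.1 (fun l => emb (Sum.inl l)) (emb (Sum.inr d.entry))
      (fun l => hM (Sum.inl l)) v
    obtain ⟨v₂, h₂⟩ := ih' hc.2 (fun l => emb (Sum.inr l)) exit (fun l => hM (Sum.inr l)) v₁
    exact ⟨v₂, h₁.trans h₂⟩
  | @ifNil k e t f S S' n hk _ ih =>
    obtain ⟨v₁, h₁⟩ := ih hc.2.1 (fun l => emb (some (Sum.inl l))) exit (fun l => hM _) none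
    refine ⟨v₁, Nat.add_comm 1 n ▸ Steps.trans (Steps.one ?_) h₁⟩
    have := step_pop hc.1 (hM none) v S
    rwa [hk, List.head?_nil, List.tail_nil, Function.update_eq_self_iff.2 hk.symm] at this
  | @ifTrue k e t f S S' n l hk _ ih =>
    obtain ⟨v₁, h₁⟩ := ih hc.2.2.1 (fun l => emb (some (Sum.inr (Sum.inl l)))) exit
      (fun l => hM _) (some true)
    refine ⟨v₁, Nat.add_comm 1 n ▸ Steps.trans (Steps.one ?_) h₁⟩
    have := step_pop hc.1 (hM none) v S
    rwa [hk, List.head?_cons, List.tail_cons] at this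
  | @ifFalse k e t f S S' n l hk _ ih =>
    obtain ⟨v₁, h₁⟩ := ih hc.2.2.2 (fun l => emb (some (Sum.inr (Sum.inr l)))) exit
      (fun l => hM _) (some false)
    refine ⟨v₁, Nat.add_comm 1 n ▸ Steps.trans (Steps.one ?_) h₁⟩
    have := step_pop hc.1 (hM none) v S
    rwa [hk, List.head?_cons, List.tail_cons] at this
  | @loopNil k t f S hk =>
    refine ⟨none, Steps.one ?_⟩
    have := step_pop hc.1 (hM none) v S
    rwa [hk, List.head?_nil, List.tail_nil, Function.update_eq_self_iff.2 hk.symm] at this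
  | @loopTrue k t f S S' S'' n m l hk _ _ ih ih' =>
    obtain ⟨v₁, h₁⟩ := ih hc.2.1 (fun l => emb (some (Sum.inl l))) (emb none)
      (fun l => hM _) (some true)
    obtain ⟨v₂, h₂⟩ := ih' hc emb exit hM v₁
    refine ⟨v₂, (by omega : 1 + (n + m) = n + m + 1) ▸ Steps.trans (Steps.one ?_) (h₁.trans h₂)⟩
    have := step_pop hc.1 (hM none) v S
    rwa [hk, List.head?_cons, List.tail_cons] at this
  | @loopFalse k t f S S' S'' n m l hk _ _ ih ih' =>
    obtain ⟨v₁, h₁⟩ := ih hc.2.2 (fun l => emb (some (Sum.inr l))) (emb none)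
      (fun l => hM _) (some false)
    obtain ⟨v₂, h₂⟩ := ih' hc emb exit hM v₁
    refine ⟨v₂, (by omega : 1 + (n + m) = n + m + 1) ▸ Steps.trans (Steps.one ?_) (h₁.trans h₂)⟩
    have := step_pop hc.1 (hM none) v S
    rwa [hk, List.head?_cons, List.tail_cons] at this

/-- The machine of a program; register `0` holds the input and the output. -/
noncomputable def machine (c : Cmd) (r : ℕ) : Turing.FinTM2 where
  K := Fin (r + 1)
  k₀ := 0
  k₁ := 0
  Γ _ := Bool
  Λ := Option c.Label
  main := some c.entry
  ΛFin := have := c.labelFintype; inferInstance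
  σ := Option Bool
  initialState := none
  m l := match l with
    -- A halting configuration must have the initial internal state, so the last popped bit is
    -- erased. This costs the one extra step in the time bound.
    | none => Turing.TM2.Stmt.load (fun _ => none) Turing.TM2.Stmt.halt
    | some l => c.code r some none l

/-- Registers of which only the first one is used. -/
def single (x : List Bool) : Regs := update (fun _ => []) 0 x

theorem toStk_single (r : ℕ) (x : List Bool) :
    toStk r (single x) = update (fun _ => []) 0 x := by
  funext i
  by_cases hi : i = 0
  · subst hi; simp [toStk, single]
  · have : (i : ℕ) ≠ 0 := fun e => hi (Fin.ext e)
    simp [toStk, single, hi, this]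

theorem update_zero_of_ne {r : ℕ} {k : Fin (r + 1)} (hk : k ≠ 0) (x : List Bool) :
    update (fun _ : Fin (r + 1) => ([] : List Bool)) 0 x k = [] := by
  simp [hk]

theorem initList_machine (c : Cmd) (r : ℕ) (x : List Bool) :
    Turing.initList (c.machine r) x = ⟨some (some c.entry), none, toStk r (single x)⟩ := by
  rw [toStk_single]
  unfold Turing.initList
  congr 1
  funext k
  by_cases hk : k = (0 : Fin (r + 1))
  · subst hk; rfl
  · exact (dif_neg hk).trans (update_zero_of_ne hk x).symm

theorem haltList_machine (c : Cmd) (r : ℕ) (x : List Bool) :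
    Turing.haltList (c.machine r) x = ⟨none, none, toStk r (single x)⟩ := by
  rw [toStk_single]
  unfold Turing.haltList
  congr 1
  funext k
  by_cases hk : k = (0 : Fin (r + 1))
  · subst hk; rfl
  · exact (dif_neg hk).trans (update_zero_of_ne hk x).symm

/-- A program that runs in polynomial time yields a machine that does. -/
theorem computableInPolyTime {α β : Type} (ea : α → List Bool) (eb : β → List Bool) (f : α → β)
    (c : Cmd) (p : Polynomial ℕ)
    (h : ∀ a, ∃ n ≤ p.eval (ea a).length, Run c (single (ea a)) n (single (eb (f a)))) :
    Nonempty (Turing.TM2ComputableInPolyTime ea eb f) := by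
  obtain ⟨r, hr⟩ := c.exists_below
  refine ⟨{ tm := c.machine r, inputAlphabet := Equiv.refl Bool, outputAlphabet := Equiv.refl Bool,
            time := p + 1, outputsFun := fun a => ?_ }⟩
  have key : ∃ n ≤ (p + 1).eval (ea a).length, Steps (c.machine r).step n
      (Turing.initList (c.machine r) (ea a)) (Turing.haltList (c.machine r) (eb (f a))) := by
    obtain ⟨n, hn, hrun⟩ := h a
    obtain ⟨v, hv⟩ := hrun.steps (c.machine r).m hr some none (fun l => rfl) none
    refine ⟨n + 1, by simpa using hn, ?_⟩
    rw [initList_machine, haltList_machine]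
    exact hv.trans (Steps.one rfl)
  obtain hk := key.choose_spec
  refine ⟨⟨key.choose, ?_⟩, hk.1⟩
  generalize key.choose = n at hk ⊢
  exact (congrArg (fun x => (flip bind (c.machine r).step)^[n]
    (some (Turing.initList (c.machine r) x))) (List.map_id (ea a))).trans
    (Eq.trans hk.2 (congrArg (fun x => some (Turing.haltList (c.machine r) x))
      (List.map_id (eb (f a))).symm))

/-! ### Moving and copying registers -/

/-- Move register `i` in reverse order to register `j`. -/
def rev (i j : ℕ) : Cmd := loop i (push j true) (push j false)

/-- Move register `i` to register `j`; register `t` is scratch space. -/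
def mv (i j t : ℕ) : Cmd := seq (rev i t) (rev t j)

/-- Empty register `i`. -/
def clear (i : ℕ) : Cmd := loop i skip skip

/-- Move register `t` in reverse order to the registers `i` and `j`. -/
def dup (t i j : ℕ) : Cmd :=
  loop t (seq (push i true) (push j true)) (seq (push i false) (push j false))

/-- Copy register `i` to register `j`; register `t` is scratch space. -/
def copy (i j t : ℕ) : Cmd := seq (rev i t) (dup t i j)

theorem Run.congr {c : Cmd} {S S' T : Regs} {n m : ℕ} (h : Run c S n S') (hn : n = m)
    (hS : S' = T) : Run c S m T := hn ▸ hS ▸ h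

theorem Run.start {c : Cmd} {S S' T : Regs} {n : ℕ} (h : Run c S n S') (hS : T = S) :
    Run c T n S' := hS ▸ h

theorem run_rev {i j : ℕ} (hij : i ≠ j) (l : List Bool) (S : Regs) (hS : S i = l) :
    Run (rev i j) S (2 * l.length + 1) (update (update S j (l.reverse ++ S j)) i []) := by
  induction l generalizing S with
  | nil =>
    refine (Run.loopNil hS).congr (by simp) ?_
    funext k
    simp only [Function.update_apply]
    split_ifs <;> simp_all
  | cons b l ih =>
    have h := ih (update (update S i l) j (b :: update S i l j)) (by simp [hij])
    cases b
    · refine (Run.loopFalse hS (Run.push _ _ _) h).congr (by simp; omega) ?_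
      funext k
      simp only [Function.update_apply]
      split_ifs <;> simp_all
    · refine (Run.loopTrue hS (Run.push _ _ _) h).congr (by simp; omega) ?_
      funext k
      simp only [Function.update_apply]
      split_ifs <;> simp_all

theorem run_clear {i : ℕ} (l : List Bool) (S : Regs) (hS : S i = l) :
    Run (clear i) S (2 * l.length + 1) (update S i []) := by
  induction l generalizing S with
  | nil =>
    refine (Run.loopNil hS).congr (by simp) ?_
    rw [← hS, Function.update_eq_self]
  | cons b l ih =>
    have h := ih (update S i l) (by simp)
    cases b
    · exact (Run.loopFalse hS (Run.skip _) h).congr (by simp; omega) (by simp)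
    · exact (Run.loopTrue hS (Run.skip _) h).congr (by simp; omega) (by simp)

theorem run_dup {t i j : ℕ} (hti : t ≠ i) (htj : t ≠ j) (hij : i ≠ j) (l : List Bool) (S : Regs)
    (hS : S t = l) :
    Run (dup t i j) S (3 * l.length + 1)
      (update (update (update S i (l.reverse ++ S i)) j (l.reverse ++ S j)) t []) := by
  induction l generalizing S with
  | nil =>
    refine (Run.loopNil hS).congr (by simp) ?_
    funext k
    simp only [Function.update_apply]
    split_ifs <;> simp_all
  | cons b l ih =>
    cases b
    · refine (Run.loopFalse hS (Run.seq (Run.push _ _ _) (Run.push _ _ _))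
        (ih _ ?_)).congr (by simp; omega) ?_
      · simp [hti, htj]
      · funext k
        simp only [Function.update_apply]
        split_ifs <;> simp_all
    · refine (Run.loopTrue hS (Run.seq (Run.push _ _ _) (Run.push _ _ _))
        (ih _ ?_)).congr (by simp; omega) ?_
      · simp [hti, htj]
      · funext k
        simp only [Function.update_apply]
        split_ifs <;> simp_all

theorem run_mv {i j t : ℕ} (hij : i ≠ j) (hit : i ≠ t) (htj : t ≠ j) (S : Regs) (ht : S t = []) :
    Run (mv i j t) S (4 * (S i).length + 2) (update (update S j (S i ++ S j)) i []) := by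
  refine ((run_rev hit _ S rfl).seq (run_rev htj _ _ rfl)).congr ?_ ?_
  · simp [hit.symm, ht]; omega
  · funext k
    simp only [Function.update_apply]
    split_ifs <;> simp_all

theorem run_copy {i j t : ℕ} (hij : i ≠ j) (hit : i ≠ t) (htj : t ≠ j) (S : Regs) (ht : S t = []) :
    Run (copy i j t) S (5 * (S i).length + 2) (update S j (S i ++ S j)) := by
  refine ((run_rev hit _ S rfl).seq (run_dup hit.symm htj hij _ _ rfl)).congr ?_ ?_
  · simp [hit.symm, ht]; omega
  · funext k
    simp only [Function.update_apply]
    split_ifs <;> simp_all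

/-- The loop that moves a tree from the front of register `i` in reverse order to register `j`;
register `t` counts the trees that are still to be read. -/
def parseLoop (i j t : ℕ) : Cmd :=
  loop t (ifPop i skip (seq (push j true) (seq (push t true) (push t true))) (push j false)) skip

/-- In Polish notation, a `false` completes one pending tree and a `true` replaces one pending tree
by two; register `t` holds this count in unary. The statement is in continuation form: a run from
the state after `s` is extended backwards. Thus the two subtrees of a node are handled by applying
the induction hypothesis twice, without cutting the loop into pieces. -/
theorem run_parseLoop {i j t : ℕ} (hij : i ≠ j) (hit : i ≠ t) (htj : t ≠ j) (s : SExp)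
    (rest l : List Bool) {S S' S'' : Regs} {m : ℕ} (hi : S i = s.toBits ++ rest)
    (ht : S t = true :: l)
    (hS' : S' = update (update (update S t l) i rest) j (s.toBits.reverse ++ S j))
    (h : Run (parseLoop i j t) S' m S'') :
    ∃ n ≤ 5 * s.toBits.length, Run (parseLoop i j t) S (n + m) S'' := by
  induction s generalizing S S' m rest l with
  | nil =>
    refine ⟨3, by simp [SExp.toBits], ?_⟩
    have hi' : update S t l i = false :: rest := by simpa [hit, SExp.toBits] using hi
    refine (Run.loopTrue ht (Run.ifFalse hi' (Run.push j false _)) (?_ : Run _ _ m S'')).congr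
      (by omega) rfl
    change Run (parseLoop i j t) _ _ _
    convert h using 1
    rw [hS']
    funext k
    simp only [Function.update_apply]
    split_ifs <;> simp_all [SExp.toBits]
  | cons a b iha ihb =>
    have hi' : update S t l i = true :: (a.toBits ++ (b.toBits ++ rest)) := by
      simpa [hit, SExp.toBits] using hi
    obtain ⟨n₂, hn₂, h₂⟩ := ihb (S := update (update (update S i (b.toBits ++ rest)) t (true :: l))
      j (a.toBits.reverse ++ true :: S j)) rest l (by simp [hij, hit]) (by simp [htj])
      (by
        rw [hS']
        funext k
        simp only [Function.update_apply]
        split_ifs <;> simp_all [SExp.toBits]) h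
    obtain ⟨n₁, hn₁, h₁⟩ := iha (S := update (update (update S i (a.toBits ++ (b.toBits ++ rest))) t
      (true :: true :: l)) j (true :: S j)) (b.toBits ++ rest) (true :: l) (by simp [hij, hit])
      (by simp [htj])
      (by
        funext k
        simp only [Function.update_apply]
        split_ifs <;> simp_all) h₂
    refine ⟨5 + n₁ + n₂, by simp only [SExp.toBits, List.length_cons, List.length_append]; omega, ?_⟩
    refine (Run.loopTrue ht (Run.ifTrue hi' ((Run.push j true _).seq ((Run.push t true _).seq
      (Run.push t true _)))) (?_ : Run _ _ (n₁ + (n₂ + m)) S'')).congr (by omega) rfl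
    change Run (parseLoop i j t) _ _ _
    convert h₁ using 1
    funext k
    simp only [Function.update_apply]
    split_ifs <;> simp_all

/-- Push a string. -/
def pushAll (i : ℕ) : List Bool → Cmd
  | [] => skip
  | x :: l => seq (pushAll i l) (push i x)

theorem run_pushAll (i : ℕ) (l : List Bool) (S : Regs) :
    Run (pushAll i l) S (l.length + 1) (update S i (l ++ S i)) := by
  induction l with
  | nil => exact (Run.skip S).congr rfl (by simp)
  | cons x l ih => exact (ih.seq (Run.push i x _)).congr (by simp) (by simp)

/-! ### Working with four consecutive registers -/

/-- The registers `S`, with new contents from register `b` on. -/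
def lay (S : Regs) (b : ℕ) (x y z w : List Bool) : Regs :=
  update (update (update (update S b x) (b + 1) y) (b + 2) z) (b + 3) w

section lay

variable {S : Regs} {b : ℕ}

theorem lay_apply (x y z w : List Bool) (k : ℕ) : lay S b x y z w k =
    if k = b + 3 then w else if k = b + 2 then z else if k = b + 1 then y else
      if k = b then x else S k := by
  simp only [lay, Function.update_apply]

theorem lay_one (hS : ∀ j, b < j → S j = []) (x : List Bool) :
    update S b x = lay S b x [] [] [] := by
  funext k
  have := hS k
  simp only [lay_apply, Function.update_apply]
  split_ifs <;> first | rfl | omega | exact this (by omega)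

theorem lay_two (hS : ∀ j, b < j → S j = []) (x y : List Bool) :
    update (update S b x) (b + 1) y = lay S b x y [] [] := by
  funext k
  have := hS k
  simp only [lay_apply, Function.update_apply]
  split_ifs <;> first | rfl | omega | exact this (by omega)

theorem lay_three (hS : ∀ j, b < j → S j = []) (x y z : List Bool) :
    update (update (update S b x) (b + 1) y) (b + 2) z = lay S b x y z [] := by
  funext k
  have := hS k
  simp only [lay_apply, Function.update_apply]
  split_ifs <;> first | rfl | omega | exact this (by omega)

/-- Split the tree at the front of register `b` off. -/
def split (b : ℕ) : Cmd := seq (push (b + 2) true) (parseLoop b (b + 1) (b + 2))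

theorem run_split (S : Regs) (b : ℕ) (s : SExp) (rest : List Bool) :
    ∃ n ≤ 5 * s.toBits.length + 2, Run (split b) (lay S b (s.toBits ++ rest) [] [] []) n
      (lay S b rest s.toBits.reverse [] []) := by
  obtain ⟨n, hn, h⟩ := run_parseLoop (i := b) (j := b + 1) (t := b + 2) (by omega) (by omega)
    (by omega) s rest [] (S := lay S b (s.toBits ++ rest) [] [true] []) (by simp [lay_apply])
    (by simp [lay_apply]) rfl (Run.loopNil (by simp))
  refine ⟨1 + (n + 1), by omega, (Run.push _ _ _).seq ?_⟩
  convert h using 1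
  · funext k
    simp only [lay_apply, Function.update_apply]
    split_ifs <;> first | rfl | omega
  · funext k
    simp only [lay_apply, Function.update_apply]
    split_ifs <;> first | rfl | omega | simp

end lay

end Cmd

/-! ### Functions on trees that are computable in polynomial time -/

namespace SExp

/-- The number of symbols. -/
def size (s : SExp) : ℕ := s.toBits.length

@[simp] theorem size_nil : nil.size = 1 := rfl

@[simp] theorem size_cons (a b : SExp) : (cons a b).size = a.size + b.size + 1 := by
  simp [size, toBits]

/-- The left subtree. -/
def hd : SExp → SExp
  | nil => nil
  | cons a _ => a

/-- The right subtree. -/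
def tl : SExp → SExp
  | nil => nil
  | cons _ b => b

@[simp] theorem hd_cons (a b : SExp) : (cons a b).hd = a := rfl

@[simp] theorem tl_cons (a b : SExp) : (cons a b).tl = b := rfl

theorem one_le_size (s : SExp) : 1 ≤ s.size := by
  cases s <;> simp

theorem size_hd_le (s : SExp) : s.hd.size ≤ s.size := by
  cases s <;> simp [hd]; omega

theorem size_tl_le (s : SExp) : s.tl.size ≤ s.size := by
  cases s <;> simp [tl]; omega

end SExp

theorem polynomial_eval_mono (p : Polynomial ℕ) : Monotone fun n => p.eval n := by
  intro m n h
  simp only [Polynomial.eval_eq_sum]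
  exact Finset.sum_le_sum fun i _ => Nat.mul_le_mul_left _ (Nat.pow_le_pow_left h i)

open Cmd Function SExp in
/-- There is a program that computes the code `g a` from the code `e a` in polynomial time, in
place, for every choice of the register `b`; the registers after `b` are scratch space. -/
def PolyTime {α : Type} (e g : α → SExp) : Prop :=
  ∃ (c : ℕ → Cmd) (p : Polynomial ℕ), ∀ a, (g a).size ≤ p.eval (e a).size ∧
    ∀ (b : ℕ) (S : Regs), (∀ j, b < j → S j = []) →
      ∃ n ≤ p.eval (e a).size, Run (c b) (update S b (e a).toBits) n (update S b (g a).toBits)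

namespace PolyTime

open Cmd Function SExp

variable {α β : Type} {e g h : α → SExp}

theorem refl (e : α → SExp) : PolyTime e e :=
  ⟨fun _ => skip, Polynomial.X + 1, fun a => ⟨by simp, fun b S _ =>
    ⟨1, by simp, Run.skip _⟩⟩⟩

/-- The time of the second program is bounded in the size of the intermediate value; this is why
`PolyTime` also bounds the size of the result. -/
theorem trans (hg : PolyTime e g) (hh : PolyTime g h) : PolyTime e h := by
  obtain ⟨c, p, hc⟩ := hg
  obtain ⟨d, q, hd⟩ := hh
  refine ⟨fun b => seq (c b) (d b), p + q.comp p, fun a => ?_⟩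
  have hq := polynomial_eval_mono q (hc a).1
  simp only [Polynomial.eval_add, Polynomial.eval_comp]
  refine ⟨((hd a).1.trans hq).trans (Nat.le_add_left _ _), fun b S hS => ?_⟩
  obtain ⟨n, hn, h₁⟩ := (hc a).2 b S hS
  obtain ⟨m, hm, h₂⟩ := (hd a).2 b S hS
  exact ⟨n + m, Nat.add_le_add hn (hm.trans hq), h₁.seq h₂⟩

theorem comap (hg : PolyTime e g) (f : β → α) : PolyTime (fun b => e (f b)) (fun b => g (f b)) := by
  obtain ⟨c, p, hc⟩ := hg
  exact ⟨c, p, fun b => hc (f b)⟩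

theorem congr (hg : PolyTime e g) (hgh : ∀ a, g a = h a) : PolyTime e h :=
  (funext hgh : g = h) ▸ hg

theorem const (e : α → SExp) (s : SExp) : PolyTime e fun _ => s := by
  refine ⟨fun b => seq (clear b) (pushAll b s.toBits), 2 * Polynomial.X + Polynomial.C (s.size + 2),
    fun a => ⟨by simp; omega, fun b S hS => ?_⟩⟩
  refine ⟨_, ?_, ((run_clear _ _ rfl).seq (run_pushAll b s.toBits _)).congr rfl (by simp)⟩
  simp [size]; omega

theorem cons (hg : PolyTime e g) (hh : PolyTime e h) :
    PolyTime e fun a => SExp.cons (g a) (h a) := by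
  obtain ⟨c, p, hc⟩ := hg
  obtain ⟨d, q, hd⟩ := hh
  -- Both programs run on copies of the input. The results are put back in the order second, first,
  -- `true`, since the top of a stack is the front of the string.
  refine ⟨fun b => seq (copy b (b + 1) (b + 2)) (seq (c (b + 1)) (seq (copy b (b + 2) (b + 3))
    (seq (d (b + 2)) (seq (clear b) (seq (mv (b + 2) b (b + 3)) (seq (mv (b + 1) b (b + 3))
    (push b true))))))), 5 * p + 5 * q + 12 * Polynomial.X + 10, fun a => ?_⟩
  simp only [Polynomial.eval_add, Polynomial.eval_mul, Polynomial.eval_ofNat, Polynomial.eval_X]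
  have hp := (hc a).1
  have hq := (hd a).1
  refine ⟨by simp only [size_cons]; omega, fun b S hS => ?_⟩
  obtain ⟨n, hn, h₁⟩ := (hc a).2 (b + 1) (update S b (e a).toBits) (fun j hj => by
    rw [update_of_ne (by omega)]; exact hS j (by omega))
  obtain ⟨m, hm, h₂⟩ := (hd a).2 (b + 2) (update (update S b (e a).toBits) (b + 1) (g a).toBits)
    (fun j hj => by
      rw [update_of_ne (by omega), update_of_ne (by omega)]; exact hS j (by omega))
  rw [lay_two hS, lay_two hS] at h₁
  rw [lay_three hS, lay_three hS] at h₂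
  rw [lay_one hS, lay_one hS]
  have r₁ := run_copy (i := b) (j := b + 1) (t := b + 2) (by omega) (by omega) (by omega)
    (lay S b (e a).toBits [] [] []) (by simp [lay_apply])
  have r₂ := run_copy (i := b) (j := b + 2) (t := b + 3) (by omega) (by omega) (by omega)
    (lay S b (e a).toBits (g a).toBits [] []) (by simp [lay_apply])
  have r₃ := run_clear (i := b) _ (lay S b (e a).toBits (g a).toBits (h a).toBits []) rfl
  have r₄ := run_mv (i := b + 2) (j := b) (t := b + 3) (by omega) (by omega) (by omega)
    (lay S b [] (g a).toBits (h a).toBits []) (by simp [lay_apply])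
  have r₅ := run_mv (i := b + 1) (j := b) (t := b + 3) (by omega) (by omega) (by omega)
    (lay S b (h a).toBits (g a).toBits [] []) (by simp [lay_apply])
  refine ⟨_, ?_, (r₁.congr rfl ?_).seq (h₁.seq ((r₂.congr rfl ?_).seq (h₂.seq
    ((r₃.congr rfl ?_).seq ((r₄.congr rfl ?_).seq (r₅.seq
      ((Run.push b true _).congr rfl ?_)))))))⟩
  · simp only [lay_apply]
    simp
    simp only [size] at *
    omega
  all_goals
    funext k
    simp only [lay_apply, Function.update_apply]
    split_ifs <;> first | rfl | omega | simp

theorem hd_self (e : α → SExp) : PolyTime e fun a => (e a).hd := by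
  -- A code is never empty, so the first branch is unreachable. Popping `true` leaves the codes of
  -- the two subtrees one after the other; popping `false` has consumed a leaf, which is restored.
  refine ⟨fun b => ifPop b skip (seq (split b) (seq (clear b) (rev (b + 1) b))) (push b false),
    10 * Polynomial.X + 10, fun a => ?_⟩
  simp only [Polynomial.eval_add, Polynomial.eval_mul, Polynomial.eval_ofNat, Polynomial.eval_X]
  refine ⟨by have := (e a).size_hd_le; omega, fun b S hS => ?_⟩
  rcases e a with _ | ⟨s, t⟩
  · exact ⟨2, by simp, Run.ifFalse (l := []) (by simp [toBits]) ((Run.push b false _).congr rfl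
      (by simp [toBits, hd]))⟩
  · obtain ⟨n, hn, h₁⟩ := run_split S b s t.toBits
    have r₁ := run_clear (i := b) _ (lay S b t.toBits s.toBits.reverse [] []) rfl
    have r₂ := run_rev (i := b + 1) (j := b) (by omega) _ (lay S b [] s.toBits.reverse [] []) rfl
    refine ⟨_, ?_, Run.ifTrue (l := s.toBits ++ t.toBits) (by simp [toBits])
      ((h₁.start ?_).seq ((r₁.congr rfl ?_).seq
        (r₂.congr rfl ?_)))⟩
    · simp only [lay_apply]
      simp
      simp only [size] at *
      omega
    · rw [← lay_one hS, update_idem]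
    · funext k
      simp only [lay_apply, Function.update_apply]
      split_ifs <;> first | rfl | omega
    · rw [lay_one hS]
      funext k
      simp only [lay_apply, Function.update_apply]
      split_ifs <;> first | rfl | omega | simp [hd]

theorem tl_self (e : α → SExp) : PolyTime e fun a => (e a).tl := by
  refine ⟨fun b => ifPop b skip (seq (split b) (clear (b + 1))) (push b false),
    10 * Polynomial.X + 10, fun a => ?_⟩
  simp only [Polynomial.eval_add, Polynomial.eval_mul, Polynomial.eval_ofNat, Polynomial.eval_X]
  refine ⟨by have := (e a).size_tl_le; omega, fun b S hS => ?_⟩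
  rcases e a with _ | ⟨s, t⟩
  · exact ⟨2, by simp, Run.ifFalse (l := []) (by simp [toBits]) ((Run.push b false _).congr rfl
      (by simp [toBits, tl]))⟩
  · obtain ⟨n, hn, h₁⟩ := run_split S b s t.toBits
    have r₁ := run_clear (i := b + 1) _ (lay S b t.toBits s.toBits.reverse [] []) rfl
    refine ⟨_, ?_, Run.ifTrue (l := s.toBits ++ t.toBits) (by simp [toBits])
      ((h₁.start ?_).seq (r₁.congr rfl ?_))⟩
    · simp only [lay_apply]
      simp
      simp only [size] at *
      omega
    · rw [← lay_one hS, update_idem]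
    · rw [lay_one hS]
      funext k
      simp only [lay_apply, Function.update_apply]
      split_ifs <;> rfl

theorem hd (hg : PolyTime e g) : PolyTime e fun a => (g a).hd := hg.trans (hd_self g)

theorem tl (hg : PolyTime e g) : PolyTime e fun a => (g a).tl := hg.trans (tl_self g)

-- The first bit of the code decides: it is `false` exactly for the leaf. In the other case the
-- remainder of the code is discarded before the branch runs.
open Classical in
theorem iteNil {c : α → SExp} (hc : PolyTime e c) (hg : PolyTime e g) (hh : PolyTime e h) :
    PolyTime e fun a => if c a = nil then g a else h a := by
  obtain ⟨d, r, hd⟩ := hc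
  obtain ⟨c₁, p, hc₁⟩ := hg
  obtain ⟨c₂, q, hc₂⟩ := hh
  refine ⟨fun b => seq (copy b (b + 1) (b + 2)) (seq (d (b + 1)) (ifPop (b + 1) skip
    (seq (clear (b + 1)) (c₂ b)) (c₁ b))), p + q + 3 * r + 5 * Polynomial.X + 10, fun a => ?_⟩
  simp only [Polynomial.eval_add, Polynomial.eval_mul, Polynomial.eval_ofNat, Polynomial.eval_X]
  have hr := (hd a).1
  have hp := (hc₁ a).1
  have hq := (hc₂ a).1
  refine ⟨by split_ifs <;> omega, fun b S hS => ?_⟩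
  obtain ⟨n, hn, h₁⟩ := (hd a).2 (b + 1) (update S b (e a).toBits) (fun j hj => by
    rw [update_of_ne (by omega)]; exact hS j (by omega))
  rw [lay_two hS, lay_two hS] at h₁
  have r₁ := run_copy (i := b) (j := b + 1) (t := b + 2) (by omega) (by omega) (by omega)
    (lay S b (e a).toBits [] [] []) (by simp [lay_apply])
  have r₁' := r₁.congr (m := 5 * (e a).size + 2) (T := lay S b (e a).toBits (e a).toBits [] [])
    (by simp [lay_apply, size]) (by
      funext k
      simp only [lay_apply, Function.update_apply]
      split_ifs <;> first | rfl | omega | simp)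
  rw [← lay_one hS] at r₁'
  cases hca : c a with
  | nil =>
    rw [if_pos rfl]
    obtain ⟨m, hm, h₂⟩ := (hc₁ a).2 b S hS
    rw [hca] at h₁
    refine ⟨_, ?_, r₁'.seq (h₁.seq (Run.ifFalse (l := []) (by simp [lay_apply, toBits])
      (h₂.start ?_)))⟩
    · omega
    · rw [lay_one hS]
      funext k
      simp only [lay_apply, Function.update_apply]
      split_ifs <;> rfl
  | cons s t =>
    rw [if_neg (by simp)]
    obtain ⟨m, hm, h₂⟩ := (hc₂ a).2 b S hS
    rw [hca] at h₁ hr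
    have r₂ := run_clear (i := b + 1) _ (lay S b (e a).toBits (s.toBits ++ t.toBits) [] []) rfl
    refine ⟨_, ?_, r₁'.seq (h₁.seq (Run.ifTrue (l := s.toBits ++ t.toBits)
      (by simp [lay_apply, toBits]) ((r₂.start ?_).seq (h₂.start ?_))))⟩
    · simp only [lay_apply]
      simp
      simp only [size_cons] at hr
      simp only [size] at *
      omega
    · funext k
      simp only [lay_apply, Function.update_apply]
      split_ifs <;> first | rfl | omega
    · rw [lay_one hS]
      funext k
      simp only [lay_apply, Function.update_apply]
      split_ifs <;> rfl

/-- Bounded iteration. -/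
theorem iterate {σ : Type} {es : σ → SExp} {f : σ → σ} (hf : PolyTime es fun s => es (f s))
    {cnt : α → SExp} {s₀ : α → σ} (hc : PolyTime e cnt) (hs : PolyTime e fun a => es (s₀ a))
    (q : Polynomial ℕ)
    (hq : ∀ a k, k ≤ (cnt a).size → (es (f^[k] (s₀ a))).size ≤ q.eval (e a).size) :
    PolyTime e fun a => es (f^[(cnt a).size] (s₀ a)) := by
  obtain ⟨c, p, hp⟩ := hc.cons hs
  obtain ⟨d, r, hr⟩ := hf
  -- The counter is a bit string of which only the length matters, so both branches of the loop run
  -- the same body. The state sits in register `b + 1`; the uniform bound `Q` on its size bounds the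
  -- time of each round.
  have loop_run : ∀ (b : ℕ) (S : Regs), (∀ j, b < j → S j = []) → ∀ (Q : ℕ) (l : List Bool) (s : σ),
      (∀ k ≤ l.length, (es (f^[k] s)).size ≤ Q) → ∃ n ≤ l.length * (r.eval Q + 1) + 1,
      Run (loop b (d (b + 1)) (d (b + 1))) (lay S b l (es s).toBits [] []) n
        (lay S b [] (es (f^[l.length] s)).toBits [] []) := by
    intro b S hS Q l
    induction l with
    | nil => exact fun s _ => ⟨1, by simp, Run.loopNil (by simp [lay_apply])⟩
    | cons x l ih =>
      intro s hsz
      obtain ⟨n, hn, h₁⟩ := (hr s).2 (b + 1) (update S b l) (fun j hj => by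
        rw [update_of_ne (by omega)]; exact hS j (by omega))
      rw [lay_two hS, lay_two hS] at h₁
      have hn' : n ≤ r.eval Q := hn.trans (polynomial_eval_mono r (hsz 0 (Nat.zero_le _)))
      obtain ⟨m, hm, h₂⟩ := ih (f s) (fun k hk => by
        rw [← iterate_succ_apply]; exact hsz (k + 1) (by simpa using hk))
      have e₁ : update (lay S b (x :: l) (es s).toBits [] []) b l
          = lay S b l (es s).toBits [] [] := by
        funext k
        simp only [lay_apply, Function.update_apply]
        split_ifs <;> first | rfl | omega
      have e₂ : lay S b (x :: l) (es s).toBits [] [] b = x :: l := by simp [lay_apply]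
      refine ⟨n + m + 1, ?_, ?_⟩
      · rw [List.length_cons, Nat.succ_mul]; omega
      · rw [List.length_cons, iterate_succ_apply]
        cases x
        · exact Run.loopFalse e₂ (h₁.start e₁) h₂
        · exact Run.loopTrue e₂ (h₁.start e₁) h₂
  refine ⟨fun b => seq (c b) (ifPop b skip (seq (split b) (seq (mv b (b + 2) (b + 3))
    (seq (rev (b + 1) b) (seq (mv (b + 2) (b + 1) (b + 3)) (seq (loop b (d (b + 1)) (d (b + 1)))
    (mv (b + 1) b (b + 2))))))) skip),
    20 * p + p * (r.comp q + 1) + 4 * q + 20, fun a => ?_⟩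
  simp only [Polynomial.eval_add, Polynomial.eval_mul, Polynomial.eval_ofNat, Polynomial.eval_one,
    Polynomial.eval_comp]
  have hpa := (hp a).1
  have hqa := hq a _ le_rfl
  refine ⟨by omega, fun b S hS => ?_⟩
  obtain ⟨n, hn, h₁⟩ := (hp a).2 b S hS
  obtain ⟨m, hm, h₂⟩ := run_split S b (cnt a) (es (s₀ a)).toBits
  have r₁ := run_mv (i := b) (j := b + 2) (t := b + 3) (by omega) (by omega) (by omega)
    (lay S b (es (s₀ a)).toBits (cnt a).toBits.reverse [] []) (by simp [lay_apply])
  have r₂ := run_rev (i := b + 1) (j := b) (by omega) _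
    (lay S b [] (cnt a).toBits.reverse (es (s₀ a)).toBits []) rfl
  have r₃ := run_mv (i := b + 2) (j := b + 1) (t := b + 3) (by omega) (by omega) (by omega)
    (lay S b (cnt a).toBits [] (es (s₀ a)).toBits []) (by simp [lay_apply])
  obtain ⟨k, hk, h₃⟩ := loop_run b S hS _ (cnt a).toBits (s₀ a) (hq a)
  have r₄ := run_mv (i := b + 1) (j := b) (t := b + 2) (by omega) (by omega) (by omega)
    (lay S b [] (es (f^[(cnt a).toBits.length] (s₀ a))).toBits [] []) (by simp [lay_apply])
  refine ⟨_, ?_, h₁.seq (Run.ifTrue (l := (cnt a).toBits ++ (es (s₀ a)).toBits)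
    (by simp [toBits]) ((h₂.start ?_).seq ((r₁.congr rfl ?_).seq ((r₂.congr rfl ?_).seq
      ((r₃.congr rfl ?_).seq (h₃.seq (r₄.congr rfl ?_)))))))⟩
  · simp only [size_cons] at hpa
    have hkk : (cnt a).toBits.length * (r.eval (q.eval (e a).size) + 1)
        ≤ p.eval (e a).size * (r.eval (q.eval (e a).size) + 1) :=
      Nat.mul_le_mul_right _ (by simp only [size] at *; omega)
    simp only [lay_apply]
    simp
    simp only [size] at *
    omega
  · rw [← lay_one hS, update_idem]
  all_goals first | rw [lay_one hS] | skip
  all_goals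
    funext k
    simp only [lay_apply, Function.update_apply]
    split_ifs <;> first | rfl | omega | simp [size]

open Classical in
/-- Comparison with a constant. -/
theorem iteEq {c : α → SExp} (hc : PolyTime e c) (s : SExp) (hg : PolyTime e g)
    (hh : PolyTime e h) : PolyTime e fun a => if c a = s then g a else h a := by
  induction s generalizing c g h with
  | nil => exact iteNil hc hg hh
  | cons s t ihs iht =>
    refine (iteNil hc hh (ihs hc.hd (iht hc.tl hg hh) hh)).congr fun a => ?_
    rcases c a with _ | ⟨u, v⟩
    · simp
    · by_cases hu : u = s <;> by_cases hv : v = t <;> simp [hu, hv]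

end PolyTime

/-! ### Derivability -/

namespace Provable

variable {α : Type} {C : Set FmL}

theorem ofAxiom {S : Sequent α} (h : IsAxiom C S) : Provable C S :=
  ⟨.leaf ⟨S.ant.toList, S.suc⟩, by
    simpa [ProofTree.IsProof, Line.toSequent] using h, by
    simp [ProofTree.concl, ProofTree.root, Line.toSequent]⟩

theorem ofRule₁ {P S : Sequent α} (h : Rule₁ P S) (hP : Provable C P) : Provable C S := by
  obtain ⟨π, hπ, rfl⟩ := hP
  exact ⟨.unary ⟨S.ant.toList, S.suc⟩ π, ⟨hπ, by simpa [Line.toSequent] using h⟩, by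
    simp [ProofTree.concl, ProofTree.root, Line.toSequent]⟩

theorem ofRule₂ {P Q S : Sequent α} (h : Rule₂ P Q S) (hP : Provable C P) (hQ : Provable C Q) :
    Provable C S := by
  obtain ⟨π, hπ, rfl⟩ := hP
  obtain ⟨ρ, hρ, rfl⟩ := hQ
  exact ⟨.binary ⟨S.ant.toList, S.suc⟩ π ρ, ⟨hπ, hρ, by simpa [Line.toSequent] using h⟩, by
    simp [ProofTree.concl, ProofTree.root, Line.toSequent]⟩

theorem weaken {Γ : Multiset (Fm α)} {Δ : Option (Fm α)} (h : Provable C ⟨Γ, Δ⟩)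
    (M : Multiset (Fm α)) : Provable C ⟨M + Γ, Δ⟩ := by
  induction M using Multiset.induction_on with
  | empty => simpa using h
  | cons A M ih => rw [Multiset.cons_add]; exact ofRule₁ (.weakL _ _ A) ih

theorem contract {Γ M : Multiset (Fm α)} {Δ : Option (Fm α)} (h : Provable C ⟨Γ + M, Δ⟩)
    (hΓ : ∀ A ∈ Γ, A ∈ M) : Provable C ⟨M, Δ⟩ := by
  induction Γ using Multiset.induction_on with
  | empty => simpa using h
  | cons A Γ ih =>
    refine ih ?_ fun B hB => hΓ B (Multiset.mem_cons_of_mem hB)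
    obtain ⟨M', rfl⟩ := Multiset.exists_cons_of_mem (hΓ A (Multiset.mem_cons_self A Γ))
    rw [Multiset.add_cons]
    refine ofRule₁ (.contrL _ _ A) ?_
    rwa [Multiset.cons_add, Multiset.add_cons] at h

/-- Weaken by all of `M`, then contract `Γ` into it. Multiplicities are thus irrelevant, which
justifies working with sets of hypotheses below. -/
theorem ofSubset {Γ M : Multiset (Fm α)} {Δ : Option (Fm α)} (h : Provable C ⟨Γ, Δ⟩)
    (hΓ : ∀ A ∈ Γ, A ∈ M) : Provable C ⟨M, Δ⟩ :=
  contract (add_comm M Γ ▸ h.weaken M) hΓ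

end Provable

/-- `A` is derivable from finitely many formulas of the set `X`. -/
def Entails {α : Type} (C : Set FmL) (X : Set (Fm α)) (A : Fm α) : Prop :=
  ∃ Γ : Multiset (Fm α), (∀ B ∈ Γ, B ∈ X) ∧ Provable C ⟨Γ, some A⟩

namespace Entails

variable {α : Type} {C : Set FmL} {X Y : Set (Fm α)} {A B D : Fm α}

theorem hyp (h : A ∈ X) : Entails C X A :=
  ⟨{A}, by simpa using h, .ofAxiom (.id 0 A)⟩

theorem mono (h : Entails C X A) (hXY : X ⊆ Y) : Entails C Y A := by
  obtain ⟨Γ, hΓ, h⟩ := h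
  exact ⟨Γ, fun B hB => hXY (hΓ B hB), h⟩

theorem provable (h : Entails C X A) {M : Multiset (Fm α)} (hM : ∀ B ∈ X, B ∈ M) :
    Provable C ⟨M, some A⟩ := by
  obtain ⟨Γ, hΓ, h⟩ := h
  exact h.ofSubset fun B hB => hM B (hΓ B hB)

-- The formula `A` may be used any number of times, even zero; keeping the hypotheses from `X` and
-- adding `A` once brings the sequent into the shape the left and right rules expect.
open Classical in
theorem exists_cons (h : Entails C (insert A X) B) :
    ∃ Γ : Multiset (Fm α), (∀ D ∈ Γ, D ∈ X) ∧ Provable C ⟨A ::ₘ Γ, some B⟩ := by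
  obtain ⟨Γ, hΓ, h⟩ := h
  refine ⟨Γ.filter (· ∈ X), fun D hD => (Multiset.mem_filter.1 hD).2, h.ofSubset fun D hD => ?_⟩
  rcases hΓ D hD with rfl | hX
  · exact Multiset.mem_cons_self _ _
  · exact Multiset.mem_cons_of_mem (Multiset.mem_filter.2 ⟨hD, hX⟩)

theorem impI (h : Entails C (insert A X) B) : Entails C X (.imp A B) := by
  obtain ⟨Γ, hΓ, h⟩ := h.exists_cons
  exact ⟨Γ, hΓ, .ofRule₁ (.impR Γ A B) h⟩

theorem mp (h : Entails C X (.imp A B)) (hA : Entails C X A) : Entails C X B := by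
  obtain ⟨Γ, hΓ, h⟩ := h
  obtain ⟨Θ, hΘ, hA⟩ := hA
  refine ⟨Γ + Θ, fun D hD => (Multiset.mem_add.1 hD).elim (hΓ D) (hΘ D), ?_⟩
  refine .ofRule₂ (.cut _ _ (.imp A B)) (add_comm Θ Γ ▸ h.weaken Θ) ?_
  exact .ofRule₂ (.impL _ _ A B) (hA.weaken Γ) (.ofAxiom (.id _ B))

theorem cut (hA : Entails C X A) (h : Entails C (insert A X) B) : Entails C X B :=
  h.impI.mp hA

/-- Hypotheses are moved one at a time into an implication on the right and discharged by modus
ponens; therefore the induction varies `A`. -/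
theorem cutSet (h : Entails C Y A) (hY : ∀ B ∈ Y, Entails C X B) : Entails C X A := by
  obtain ⟨Γ, hΓ, h⟩ := h
  induction Γ using Multiset.induction_on generalizing A with
  | empty => exact ⟨0, by simp, h⟩
  | cons B Γ ih =>
    exact (ih (fun D hD => hΓ D (Multiset.mem_cons_of_mem hD)) (.ofRule₁ (.impR Γ B A) h)).mp
      (hY B (hΓ B (Multiset.mem_cons_self B Γ)))

theorem topI : Entails C X .top := ⟨0, by simp, .ofAxiom (.topR 0)⟩

theorem botE (h : Entails C X .bot) : Entails C X A :=
  h.cut ⟨{.bot}, by simp, .ofAxiom (.botL 0 _)⟩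

theorem andI (hA : Entails C X A) (hB : Entails C X B) : Entails C X (.and A B) := by
  obtain ⟨Γ, hΓ, hA⟩ := hA
  obtain ⟨Θ, hΘ, hB⟩ := hB
  exact ⟨Γ + Θ, fun D hD => (Multiset.mem_add.1 hD).elim (hΓ D) (hΘ D),
    .ofRule₂ (.andR _ A B) (add_comm Θ Γ ▸ hA.weaken Θ) (hB.weaken Γ)⟩

theorem andE₁ (h : Entails C X (.and A B)) : Entails C X A :=
  h.cut ⟨{.and A B}, by simp, .ofRule₁ (.andL₁ 0 _ A B) (.ofAxiom (.id 0 A))⟩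

theorem andE₂ (h : Entails C X (.and A B)) : Entails C X B :=
  h.cut ⟨{.and A B}, by simp, .ofRule₁ (.andL₂ 0 _ A B) (.ofAxiom (.id 0 B))⟩

theorem orI₁ (h : Entails C X A) : Entails C X (.or A B) := by
  obtain ⟨Γ, hΓ, h⟩ := h
  exact ⟨Γ, hΓ, .ofRule₁ (.orR₁ Γ A B) h⟩

theorem orI₂ (h : Entails C X B) : Entails C X (.or A B) := by
  obtain ⟨Γ, hΓ, h⟩ := h
  exact ⟨Γ, hΓ, .ofRule₁ (.orR₂ Γ A B) h⟩

theorem orE (h : Entails C X (.or A B)) (hA : Entails C (insert A X) D)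
    (hB : Entails C (insert B X) D) : Entails C X D := by
  obtain ⟨Γ, hΓ, hA⟩ := hA.exists_cons
  obtain ⟨Θ, hΘ, hB⟩ := hB.exists_cons
  refine h.cut ⟨.or A B ::ₘ (Γ + Θ), fun E hE => ?_, .ofRule₂ (.orL (Γ + Θ) _ A B) ?_ ?_⟩
  · rcases Multiset.mem_cons.1 hE with rfl | hE
    · exact Set.mem_insert _ _
    · exact Set.mem_insert_of_mem _ ((Multiset.mem_add.1 hE).elim (hΓ E) (hΘ E))
  · refine hA.ofSubset fun E hE => ?_
    rw [Multiset.mem_cons] at hE ⊢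
    exact hE.imp_right fun h => Multiset.mem_add.2 (Or.inl h)
  · refine hB.ofSubset fun E hE => ?_
    rw [Multiset.mem_cons] at hE ⊢
    exact hE.imp_right fun h => Multiset.mem_add.2 (Or.inr h)

/-- The formulas whose boxes are derivable. -/
def unbox (C : Set FmL) (X : Set (Fm α)) : Set (Fm α) := {B | Entails C X (.box B)}

/-- This frees `K_□` from the requirement that the context consist of boxes: the boxed premises only
have to be derivable and are cut in. `diaE` does the same for `K_◇`. -/
theorem boxI (h : Entails C (unbox C X) A) : Entails C X (.box A) := by
  obtain ⟨Γ, hΓ, h⟩ := h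
  refine cutSet (Y := {B | B ∈ Γ.map Fm.box}) ⟨_, fun B hB => hB, .ofRule₁ (.kBox Γ A) h⟩ ?_
  intro B hB
  obtain ⟨D, hD, rfl⟩ := Multiset.mem_map.1 hB
  exact hΓ D hD

theorem diaE (hA : Entails C X (.dia A)) (h : Entails C (insert A (unbox C X)) B) :
    Entails C X (.dia B) := by
  obtain ⟨Γ, hΓ, h⟩ := h.exists_cons
  refine cutSet (Y := {B | B ∈ Fm.dia A ::ₘ Γ.map Fm.box})
    ⟨_, fun B hB => hB, .ofRule₁ (.kDia Γ A B) h⟩ ?_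
  intro B hB
  rcases Multiset.mem_cons.1 hB with rfl | hB
  · exact hA
  · obtain ⟨D, hD, rfl⟩ := Multiset.mem_map.1 hB
    exact hΓ D hD

theorem ofMem {A : FmL} (hA : A ∈ C) (v : ℕ → Fm α) : Entails C X (A.subst v) :=
  ⟨0, by simp, .ofAxiom (.ofMem A hA v)⟩

end Entails

/-! ### Horn formulas over angled atoms -/

/-- Modal Horn formulas constructed from angled atoms only. -/
def AngledHorn (F : FmPlus) : Prop := F.ModalHorn ∧ FromAngledAtoms F

namespace AngledHorn

theorem angled (φ : FmL) : AngledHorn (angled φ) := ⟨.atom _, trivial⟩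

theorem box {F : FmPlus} (h : AngledHorn F) : AngledHorn (.box F) := ⟨.box h.1, h.2⟩

/-- Premises with a single conjunct suffice throughout, since several premises can be curried. The
exponent `0` is the bare atom; `diaImp` uses the exponent `1`. -/
theorem imp (φ : FmL) {F : FmPlus} (h : AngledHorn F) :
    AngledHorn (.imp (ModalHornTranslation.angled φ) F) :=
  ⟨.imp [(0, Sum.inr φ)] (by simp) h.1, trivial, h.2⟩

theorem diaImp (φ : FmL) {F : FmPlus} (h : AngledHorn F) :
    AngledHorn (.imp (.dia (ModalHornTranslation.angled φ)) F) :=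
  ⟨.imp [(1, Sum.inr φ)] (by simp) h.1, trivial, h.2⟩

end AngledHorn

/-- The effect of a substitution on the atoms of `𝓛⁺`. -/
def instAtom (v : ℕ → FmL) : ℕ ⊕ FmL → FmL := Sum.elim v (Fm.subst v)

/-- Apply a substitution inside of the angled atoms. -/
def inst (v : ℕ → FmL) : FmPlus → FmPlus := Fm.subst fun a => angled (instAtom v a)

theorem subst_conj {α β : Type} (v : α → Fm β) (L : List (Fm α)) :
    (Fm.conj L).subst v = Fm.conj (L.map (Fm.subst v)) := by
  induction L with
  | nil => rfl
  | cons A L ih =>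
    cases L with
    | nil => rfl
    | cons B L => simpa [Fm.conj, Fm.subst] using ih

theorem subst_iterate_dia {α β : Type} (v : α → Fm β) (n : ℕ) (A : Fm α) :
    (Fm.dia^[n] A).subst v = Fm.dia^[n] (A.subst v) := by
  induction n generalizing A with
  | zero => rfl
  | succ n ih => simp only [Function.iterate_succ_apply, ih]; rfl

theorem AngledHorn.inst {F : FmPlus} (h : AngledHorn F) (v : ℕ → FmL) :
    AngledHorn (inst v F) := by
  obtain ⟨h, h'⟩ := h
  constructor
  · clear h'
    induction h with
    | bot => exact .bot
    | atom a => exact .atom _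
    | box _ ih => exact .box ih
    | imp L hL _ ih =>
      have := Fm.ModalHorn.imp (L.map fun q => (q.1, (Sum.inr (instAtom v q.2) : ℕ ⊕ FmL)))
        (by simpa using hL) ih
      simpa [ModalHornTranslation.inst, Fm.subst, subst_conj, Function.comp_def, subst_iterate_dia,
        ModalHornTranslation.angled] using this
  · clear h
    induction F with
    | atom a => trivial
    | bot => exact h'
    | top => exact h'
    | and A B ihA ihB => exact ⟨ihA h'.1, ihB h'.2⟩
    | or A B ihA ihB => exact ⟨ihA h'.1, ihB h'.2⟩
    | imp A B ihA ihB => exact ⟨ihA h'.1, ihB h'.2⟩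
    | box A ih => exact ih h'
    | dia A ih => exact ih h'

theorem subst_subst {α β γ : Type} (v : α → Fm β) (w : β → Fm γ) (A : Fm α) :
    (A.subst v).subst w = A.subst fun a => (v a).subst w := by
  induction A <;> simp_all [Fm.subst]

/-- Consequently one fixed proof of the standard substitution of `F` yields, by substitution, a
proof for every instance of `F`. -/
theorem stdSubst_inst (v : ℕ → FmL) (F : FmPlus) :
    stdSubst (inst v F) = (stdSubst F).subst v := by
  unfold stdSubst inst
  rw [subst_subst, subst_subst]
  congr 1
  funext a
  cases a <;> rfl

/-! ### Instances of constructive formulas -/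

section Constructive

variable {C : Set FmL}

/-- The angled atom is a conjunct of the translation or the translation itself, except for `⊥`,
where ex falso provides it. -/
theorem Entails.angled {X : Set FmPlus} {F : FmL} (h : Entails C X (transl F)) :
    Entails C X (angled F) := by
  cases F with
  | atom p => exact h
  | bot => exact h.botE
  | top => exact h
  | and A B => exact h.andE₂
  | or A B => exact h.andE₂
  | imp A B => exact h.andE₂
  | box A => exact h.andE₂
  | dia A => exact h.andE₂

/-- With the help of finitely many derivable Horn formulas, `A(φ)ᵗ` follows from `A(φᵗ)`. -/
def TranslFromSubst (C : Set FmL) (A : FmL) : Prop :=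
  ∃ H : List FmPlus, (∀ F ∈ H, AngledHorn F ∧ Entails C ∅ (stdSubst F)) ∧
    ∀ (v : ℕ → FmL) (X : Set FmPlus), (∀ F ∈ H, Entails C X (inst v F)) →
      Entails C X (A.subst fun p => transl (v p)) → Entails C X (transl (A.subst v))

/-- With the help of finitely many derivable Horn formulas, `A(φᵗ)` follows from `A(φ)ᵗ`. -/
def SubstFromTransl (C : Set FmL) (A : FmL) : Prop :=
  ∃ H : List FmPlus, (∀ F ∈ H, AngledHorn F ∧ Entails C ∅ (stdSubst F)) ∧
    ∀ (v : ℕ → FmL) (X : Set FmPlus), (∀ F ∈ H, Entails C X (inst v F)) →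
      Entails C X (transl (A.subst v)) → Entails C X (A.subst fun p => transl (v p))

/-- With the help of finitely many Horn formulas that follow from `A`, `A(φ)ᵗ` follows from
`A(φᵗ)`. -/
def RelTranslFromSubst (C : Set FmL) (A : FmL) : Prop :=
  ∃ H : List FmPlus, (∀ F ∈ H, AngledHorn F ∧ Entails C {A} (stdSubst F)) ∧
    ∀ (v : ℕ → FmL) (X : Set FmPlus), (∀ F ∈ H, Entails C X (inst v F)) →
      Entails C X (A.subst fun p => transl (v p)) → Entails C X (transl (A.subst v))

theorem entails_box_of_entails {α : Type} {A : Fm α} {X : Set (Fm α)} (h : Entails C ∅ A) :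
    Entails C X (.box A) :=
  Entails.boxI (h.mono (Set.empty_subset _))

/-- The structural conjuncts come from the induction; the angled ones from tautologies of Horn
shape, namely `⟨A⟩ → ⟨B⟩ → ⟨A ∧ B⟩`, `⟨A⟩ → ⟨A ∨ B⟩`, `⟨B⟩ → ⟨A ∨ B⟩`, `◇⟨A⟩ → ⟨◇A⟩` and `⟨⊤⟩`. The
analogues for `□` and `→` have a box or an implication as premise and are not Horn, hence the
restriction to basic formulas. -/
theorem TranslFromSubst.ofBasic {A : FmL} (hA : A.Basic) : TranslFromSubst C A := by
  induction hA with
  | atom p => exact ⟨[], by simp, fun v X _ h => h⟩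
  | bot => exact ⟨[], by simp, fun v X _ h => h⟩
  | top =>
    refine ⟨[angled .top], ?_, fun v X hX _ => hX (angled .top) (by simp)⟩
    simpa using ⟨AngledHorn.angled _, Entails.topI⟩
  | @and A B _ _ ihA ihB =>
    obtain ⟨H, hH, hA⟩ := ihA
    obtain ⟨K, hK, hB⟩ := ihB
    refine ⟨H ++ K ++ [.imp (angled A) (.imp (angled B) (angled (.and A B)))], ?_,
      fun v X hX h => ?_⟩
    · simp only [List.mem_append, List.mem_singleton]
      rintro F ((hF | hF) | rfl)
      · exact hH F hF
      · exact hK F hF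
      · exact ⟨.imp _ (.imp _ (.angled _)),
          .impI (.impI (.andI (.hyp (Or.inr (Or.inl rfl))) (.hyp (Or.inl rfl))))⟩
    · have h₁ := hA v X (fun F hF => hX F (by simp [hF])) h.andE₁
      have h₂ := hB v X (fun F hF => hX F (by simp [hF])) h.andE₂
      exact .andI (.andI h₁ h₂) (((hX _ (by simp) : Entails C X (inst v
        (.imp (angled A) (.imp (angled B) (angled (.and A B)))))).mp h₁.angled).mp h₂.angled)
  | @or A B _ _ ihA ihB =>
    obtain ⟨H, hH, hA⟩ := ihA
    obtain ⟨K, hK, hB⟩ := ihB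
    refine ⟨H ++ K ++ [.imp (angled A) (angled (.or A B)), .imp (angled B) (angled (.or A B))], ?_,
      fun v X hX h => ?_⟩
    · simp only [List.mem_append, List.mem_cons, List.not_mem_nil, or_false]
      rintro F ((hF | hF) | rfl | rfl)
      · exact hH F hF
      · exact hK F hF
      · exact ⟨.imp _ (.angled _), .impI (.orI₁ (.hyp (Or.inl rfl)))⟩
      · exact ⟨.imp _ (.angled _), .impI (.orI₂ (.hyp (Or.inl rfl)))⟩
    · refine h.orE ?_ ?_
      · have h₁ := hA v _ (fun F hF => (hX F (by simp [hF])).mono (Set.subset_insert _ _))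
          (.hyp (Set.mem_insert _ X))
        exact .andI (.orI₁ h₁) (((hX _ (by simp) : Entails C X (inst v
          (.imp (angled A) (angled (.or A B))))).mono (Set.subset_insert _ _)).mp h₁.angled)
      · have h₁ := hB v _ (fun F hF => (hX F (by simp [hF])).mono (Set.subset_insert _ _))
          (.hyp (Set.mem_insert _ X))
        exact .andI (.orI₂ h₁) (((hX _ (by simp) : Entails C X (inst v
          (.imp (angled B) (angled (.or A B))))).mono (Set.subset_insert _ _)).mp h₁.angled)
  | @dia A _ ihA =>
    obtain ⟨H, hH, hA⟩ := ihA
    -- The Horn formulas for `A` are needed below the diamond, so they are supplied with a box.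
    refine ⟨H.map .box ++ [.imp (.dia (angled A)) (angled (.dia A))], ?_, fun v X hX h => ?_⟩
    · simp only [List.mem_append, List.mem_map, List.mem_singleton]
      rintro F (⟨F, hF, rfl⟩ | rfl)
      · exact ⟨(hH F hF).1.box, entails_box_of_entails (hH F hF).2⟩
      · exact ⟨.diaImp _ (.angled _), .impI (.hyp (Or.inl rfl))⟩
    · have h₁ := hA v (insert (A.subst fun p => transl (v p)) (Entails.unbox C X))
        (fun F hF => .hyp (Set.mem_insert_of_mem _ (hX (.box F) (by simp [hF]))))
        (.hyp (Set.mem_insert _ _))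
      exact .andI (Entails.diaE h h₁) ((hX _ (by simp) : Entails C X (inst v
        (.imp (.dia (angled A)) (angled (.dia A))))).mp (Entails.diaE h h₁.angled))

namespace SubstFromTransl

variable {A B : FmL}

/-- In this direction angled conjuncts are merely dropped, so no connective adds a Horn formula of
its own; `□` and `◇` only box those inherited. -/
theorem and (ihA : SubstFromTransl C A) (ihB : SubstFromTransl C B) :
    SubstFromTransl C (.and A B) := by
  obtain ⟨H, hH, hA⟩ := ihA
  obtain ⟨K, hK, hB⟩ := ihB
  refine ⟨H ++ K, ?_, fun v X hX h => ?_⟩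
  · simp only [List.mem_append]
    exact fun F hF => hF.elim (hH F) (hK F)
  · exact .andI (hA v X (fun F hF => hX F (by simp [hF])) h.andE₁.andE₁)
      (hB v X (fun F hF => hX F (by simp [hF])) h.andE₁.andE₂)

theorem or (ihA : SubstFromTransl C A) (ihB : SubstFromTransl C B) :
    SubstFromTransl C (.or A B) := by
  obtain ⟨H, hH, hA⟩ := ihA
  obtain ⟨K, hK, hB⟩ := ihB
  refine ⟨H ++ K, ?_, fun v X hX h => ?_⟩
  · simp only [List.mem_append]
    exact fun F hF => hF.elim (hH F) (hK F)
  · exact h.andE₁.orE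
      (.orI₁ (hA v _ (fun F hF => (hX F (by simp [hF])).mono (Set.subset_insert _ _))
        (.hyp (Set.mem_insert _ X))))
      (.orI₂ (hB v _ (fun F hF => (hX F (by simp [hF])).mono (Set.subset_insert _ _))
        (.hyp (Set.mem_insert _ X))))

theorem box (ihA : SubstFromTransl C A) : SubstFromTransl C (.box A) := by
  obtain ⟨H, hH, hA⟩ := ihA
  refine ⟨H.map .box, ?_, fun v X hX h => ?_⟩
  · simp only [List.mem_map]
    rintro F ⟨F, hF, rfl⟩
    exact ⟨(hH F hF).1.box, entails_box_of_entails (hH F hF).2⟩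
  · exact Entails.boxI (hA v _ (fun F hF => .hyp (hX (.box F) (by simp [hF]))) (.hyp h.andE₁))

theorem dia (ihA : SubstFromTransl C A) : SubstFromTransl C (.dia A) := by
  obtain ⟨H, hH, hA⟩ := ihA
  refine ⟨H.map .box, ?_, fun v X hX h => ?_⟩
  · simp only [List.mem_map]
    rintro F ⟨F, hF, rfl⟩
    exact ⟨(hH F hF).1.box, entails_box_of_entails (hH F hF).2⟩
  · exact Entails.diaE h.andE₁ (hA v _
      (fun F hF => .hyp (Set.mem_insert_of_mem _ (hX (.box F) (by simp [hF]))))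
      (.hyp (Set.mem_insert _ _)))

/-- The antecedent is contravariant and needs the opposite direction, which is available for basic
formulas. -/
theorem imp (ihA : TranslFromSubst C A) (ihB : SubstFromTransl C B) :
    SubstFromTransl C (.imp A B) := by
  obtain ⟨H, hH, hA⟩ := ihA
  obtain ⟨K, hK, hB⟩ := ihB
  refine ⟨H ++ K, ?_, fun v X hX h => .impI ?_⟩
  · simp only [List.mem_append]
    exact fun F hF => hF.elim (hH F) (hK F)
  · have hX' : ∀ F ∈ H ++ K, Entails C (insert (A.subst fun p => transl (v p)) X) (inst v F) :=
      fun F hF => (hX F hF).mono (Set.subset_insert _ _)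
    exact hB v _ (fun F hF => hX' F (by simp [hF])) ((h.andE₁.mono (Set.subset_insert _ _)).mp
      (hA v _ (fun F hF => hX' F (by simp [hF])) (.hyp (Set.mem_insert _ _))))

theorem ofBasic (hA : A.Basic) : SubstFromTransl C A := by
  induction hA with
  | atom p => exact ⟨[], by simp, fun v X _ h => h⟩
  | bot => exact ⟨[], by simp, fun v X _ h => h⟩
  | top => exact ⟨[], by simp, fun v X _ _ => .topI⟩
  | and _ _ ihA ihB => exact ihA.and ihB
  | or _ _ ihA ihB => exact ihA.or ihB
  | dia _ ihA => exact ihA.dia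

theorem ofAlmostPositive (hA : A.AlmostPositive) : SubstFromTransl C A := by
  induction hA with
  | basic h => exact ofBasic h
  | and _ _ ihA ihB => exact ihA.and ihB
  | or _ _ ihA ihB => exact ihA.or ihB
  | box _ ihA => exact ihA.box
  | dia _ ihA => exact ihA.dia
  | imp hA _ ihB => exact imp (.ofBasic hA) ihB

end SubstFromTransl

/-- With `A` itself as hypothesis, the atom `⟨A⟩` is an admissible Horn formula and supplies the
outer angled conjunct directly. What remains is to carry the Horn formulas of the parts outwards:
they follow from a conjunction; boxed, from a box; and with the premise `⟨A⟩`, from `A → B`. This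
transfer has no counterpart for `∨` and `◇`, which occur only inside basic formulas or antecedents.
The antecedent of an implication is contravariant, hence almost positive. -/
theorem RelTranslFromSubst.ofConstructive {A : FmL} (hA : A.Constructive) :
    RelTranslFromSubst C A := by
  induction hA with
  | basic h =>
    obtain ⟨H, hH, hA⟩ := TranslFromSubst.ofBasic (C := C) h
    exact ⟨H, fun F hF => ⟨(hH F hF).1, (hH F hF).2.mono (Set.empty_subset _)⟩, hA⟩
  | @and A B _ _ ihA ihB =>
    obtain ⟨H, hH, hA⟩ := ihA
    obtain ⟨K, hK, hB⟩ := ihB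
    refine ⟨H ++ K ++ [angled (.and A B)], ?_, fun v X hX h => ?_⟩
    · simp only [List.mem_append, List.mem_singleton]
      have hyp : Entails C {Fm.and A B} (.and A B) := .hyp rfl
      rintro F ((hF | hF) | rfl)
      · refine ⟨(hH F hF).1, (hH F hF).2.cutSet ?_⟩
        rintro _ rfl
        exact hyp.andE₁
      · refine ⟨(hK F hF).1, (hK F hF).2.cutSet ?_⟩
        rintro _ rfl
        exact hyp.andE₂
      · exact ⟨.angled _, hyp⟩
    · exact .andI (.andI (hA v X (fun F hF => hX F (by simp [hF])) h.andE₁)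
        (hB v X (fun F hF => hX F (by simp [hF])) h.andE₂)) (hX (angled (.and A B)) (by simp))
  | @box A _ ihA =>
    obtain ⟨H, hH, hA⟩ := ihA
    refine ⟨H.map .box ++ [angled (.box A)], ?_, fun v X hX h => ?_⟩
    · simp only [List.mem_append, List.mem_map, List.mem_singleton]
      rintro F (⟨F, hF, rfl⟩ | rfl)
      · refine ⟨(hH F hF).1.box, Entails.boxI ((hH F hF).2.mono ?_)⟩
        rintro _ rfl
        exact Entails.hyp rfl
      · exact ⟨.angled _, .hyp rfl⟩
    · exact .andI (Entails.boxI (hA v _ (fun F hF => .hyp (hX (.box F) (by simp [hF]))) (.hyp h)))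
        (hX (angled (.box A)) (by simp))
  | @imp A B hA _ ihB =>
    obtain ⟨H, hH, hA⟩ := SubstFromTransl.ofAlmostPositive (C := C) hA
    obtain ⟨K, hK, hB⟩ := ihB
    refine ⟨H ++ K.map (.imp (angled A)) ++ [angled (.imp A B)], ?_, fun v X hX h => ?_⟩
    · simp only [List.mem_append, List.mem_map, List.mem_singleton]
      rintro F ((hF | ⟨F, hF, rfl⟩) | rfl)
      · exact ⟨(hH F hF).1, (hH F hF).2.mono (Set.empty_subset _)⟩
      · refine ⟨.imp _ (hK F hF).1, .impI ((hK F hF).2.cutSet ?_)⟩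
        rintro _ rfl
        exact Entails.mp (A := A) (.hyp (Or.inr rfl)) (.hyp (Or.inl rfl))
      · exact ⟨.angled _, .hyp rfl⟩
    · refine .andI (.impI ?_) (hX (angled (.imp A B)) (by simp))
      have hX' : ∀ F ∈ H ++ K.map (.imp (angled A)) ++ [angled (.imp A B)],
          Entails C (insert (transl (A.subst v)) X) (inst v F) :=
        fun F hF => (hX F hF).mono (Set.subset_insert _ _)
      have hAv : Entails C (insert (transl (A.subst v)) X) (transl (A.subst v)) :=
        .hyp (Set.mem_insert _ _)
      exact hB v _ (fun F hF => (hX' (.imp (angled A) F) (by simp [hF])).mp hAv.angled)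
        ((h.mono (Set.subset_insert _ _)).mp (hA v _ (fun F hF => hX' F (by simp [hF])) hAv))

end Constructive

/-! ### Matching against a pattern -/

namespace Fm

/-- The first immediate subformula, or `⊥`. -/
def left {α : Type} : Fm α → Fm α
  | and A _ => A
  | or A _ => A
  | imp A _ => A
  | box A => A
  | dia A => A
  | _ => bot

/-- The second immediate subformula, or `⊥`. -/
def right {α : Type} : Fm α → Fm α
  | and _ B => B
  | or _ B => B
  | imp _ B => B
  | _ => bot

/-- The atom occurs in the formula. -/
def Occurs {α : Type} (p : α) : Fm α → Prop
  | atom q => p = q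
  | bot => False
  | top => False
  | and A B => A.Occurs p ∨ B.Occurs p
  | or A B => A.Occurs p ∨ B.Occurs p
  | imp A B => A.Occurs p ∨ B.Occurs p
  | box A => A.Occurs p
  | dia A => A.Occurs p

open Classical in
/-- The subformula of an instance of a pattern that stands for the atom `p`. -/
noncomputable def matchAt (p : ℕ) : FmL → FmL → FmL
  | and A B, F => if A.Occurs p then matchAt p A F.left else matchAt p B F.right
  | or A B, F => if A.Occurs p then matchAt p A F.left else matchAt p B F.right
  | imp A B, F => if A.Occurs p then matchAt p A F.left else matchAt p B F.right
  | box A, F => matchAt p A F.left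
  | dia A, F => matchAt p A F.left
  | _, F => F

theorem matchAt_subst {p : ℕ} (v : ℕ → FmL) {A : FmL} (h : A.Occurs p) :
    matchAt p A (A.subst v) = v p := by
  induction A with
  | atom q => cases h; rfl
  | bot => exact h.elim
  | top => exact h.elim
  | box A ih => exact ih h
  | dia A ih => exact ih h
  | and A B ihA ihB | or A B ihA ihB | imp A B ihA ihB =>
    by_cases hA : A.Occurs p
    · simpa [matchAt, hA, subst, left, right] using ihA hA
    · simpa [matchAt, hA, subst, left, right] using ihB (h.resolve_left hA)

theorem subst_congr {α β : Type} {v w : α → Fm β} {A : Fm α} (h : ∀ p, A.Occurs p → v p = w p) :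
    A.subst v = A.subst w := by
  induction A with
  | atom q => exact h q rfl
  | bot => rfl
  | top => rfl
  | box A ih => simp only [subst, ih h]
  | dia A ih => simp only [subst, ih h]
  | and A B ihA ihB | or A B ihA ihB | imp A B ihA ihB =>
    simp only [subst, ihA fun p hp => h p (Or.inl hp), ihB fun p hp => h p (Or.inr hp)]

/-- Matching recovers `v` only on the atoms that occur in `A`, and the instance depends on no
others. -/
theorem subst_matchAt (v : ℕ → FmL) (A : FmL) :
    A.subst (fun p => matchAt p A (A.subst v)) = A.subst v :=
  subst_congr fun _ hp => matchAt_subst v hp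

end Fm

/-! ### Translating proofs -/

/-- The formula `⟨γₙ⟩ → ⋯ → ⟨γ₁⟩ → F`. -/
def curry : List FmL → FmPlus → FmPlus
  | [], F => F
  | A :: Γ, F => curry Γ (.imp (angled A) F)

theorem Entails.ofCurry {C : Set FmL} {X : Set FmPlus} {Γ : List FmL} {F : FmPlus}
    (h : Entails C X (curry Γ F)) (hΓ : ∀ A ∈ Γ, Entails C X (ModalHornTranslation.angled A)) :
    Entails C X F := by
  induction Γ generalizing F with
  | nil => exact h
  | cons A Γ ih => exact (ih h fun B hB => hΓ B (by simp [hB])).mp (hΓ A (by simp))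

/-- The translation of the sequent holds if the formulas of `X` are given. -/
def Holds (C : Set FmL) (X : Set FmPlus) (S : Sequent ℕ) : Prop :=
  (∀ A ∈ S.ant, Entails C X (transl A)) → Entails C X (transl (S.suc.getD .bot))

section Soundness

variable {C : Set FmL} {X : Set FmPlus}

theorem Holds.ofAxiom {S : Sequent ℕ} (h : IsAxiom C S)
    (hS : ∀ D, S.suc = some D → Entails C X (angled D))
    (hS' : ∀ A ∈ C, ∀ v, S.suc = some (A.subst v) → Entails C X (transl (A.subst v))) :
    Holds C X S := by
  intro hX
  cases h with
  | id Γ A => exact hX A (Multiset.mem_cons_self _ _)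
  | botL Γ Δ => exact (hX .bot (Multiset.mem_cons_self _ _)).botE
  | topR Γ => exact hS .top rfl
  | ofMem A hA v => exact hS' A hA v rfl

/-- The premise is assumed in two forms: over extensions of `X` for the rules that keep the context,
as right implication adds a hypothesis, and over extensions of the unboxed part of `X` for the modal
rules. The angled atom of the succedent is the only contribution of `hS`. -/
theorem Holds.ofRule₁ {P S : Sequent ℕ} (h : Rule₁ P S) (hP : ∀ Y, X ⊆ Y → Holds C Y P)
    (hP' : ∀ Y, Entails.unbox C X ⊆ Y → Holds C Y P)
    (hS : ∀ D, S.suc = some D → Entails C X (angled D)) : Holds C X S := by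
  intro hX
  cases h with
  | weakL Γ Δ A => exact hP X le_rfl fun B hB => hX B (Multiset.mem_cons_of_mem hB)
  | weakR Γ A => exact (hP X le_rfl hX).botE
  | contrL Γ Δ A =>
    refine hP X le_rfl fun B hB => ?_
    rcases Multiset.mem_cons.1 hB with rfl | hB
    · exact hX _ (Multiset.mem_cons_self _ _)
    · exact hX _ hB
  | andL₁ Γ Δ A B =>
    refine hP X le_rfl fun D hD => ?_
    rcases Multiset.mem_cons.1 hD with rfl | hD
    · exact (hX _ (Multiset.mem_cons_self _ _)).andE₁.andE₁
    · exact hX _ (Multiset.mem_cons_of_mem hD)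
  | andL₂ Γ Δ A B =>
    refine hP X le_rfl fun D hD => ?_
    rcases Multiset.mem_cons.1 hD with rfl | hD
    · exact (hX _ (Multiset.mem_cons_self _ _)).andE₁.andE₂
    · exact hX _ (Multiset.mem_cons_of_mem hD)
  | orR₁ Γ A B => exact .andI (.orI₁ (hP X le_rfl hX)) (hS _ rfl)
  | orR₂ Γ A B => exact .andI (.orI₂ (hP X le_rfl hX)) (hS _ rfl)
  | impR Γ A B =>
    refine .andI (.impI (hP _ (Set.subset_insert _ _) fun D hD => ?_)) (hS _ rfl)
    rcases Multiset.mem_cons.1 hD with rfl | hD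
    · exact .hyp (Set.mem_insert _ _)
    · exact (hX D hD).mono (Set.subset_insert _ _)
  | kBox Γ A =>
    refine .andI (Entails.boxI (hP' _ le_rfl fun D hD => .hyp ?_)) (hS _ rfl)
    exact (hX (.box D) (Multiset.mem_map_of_mem _ hD)).andE₁
  | kDia Γ A B =>
    refine .andI (Entails.diaE (hX _ (Multiset.mem_cons_self _ _)).andE₁
      (hP' _ (Set.subset_insert _ _) fun D hD => .hyp ?_)) (hS _ rfl)
    rcases Multiset.mem_cons.1 hD with rfl | hD
    · exact Set.mem_insert _ _
    · exact Set.mem_insert_of_mem _ (hX (.box D)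
        (Multiset.mem_cons_of_mem (Multiset.mem_map_of_mem _ hD))).andE₁

theorem Holds.ofRule₂ {P Q S : Sequent ℕ} (h : Rule₂ P Q S) (hP : ∀ Y, X ⊆ Y → Holds C Y P)
    (hQ : ∀ Y, X ⊆ Y → Holds C Y Q)
    (hS : ∀ D, S.suc = some D → Entails C X (angled D)) : Holds C X S := by
  intro hX
  have cons {Γ : Multiset FmL} {A : FmL} (hΓ : ∀ B ∈ Γ, Entails C X (transl B)) :
      ∀ B ∈ A ::ₘ Γ, Entails C (insert (transl A) X) (transl B) := fun B hB => by
    rcases Multiset.mem_cons.1 hB with rfl | hB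
    · exact .hyp (Set.mem_insert _ _)
    · exact (hΓ B hB).mono (Set.subset_insert _ _)
  cases h with
  | cut Γ Δ A => exact (hP X le_rfl hX).cut (hQ _ (Set.subset_insert _ _) (cons hX))
  | andR Γ A B => exact .andI (.andI (hP X le_rfl hX) (hQ X le_rfl hX)) (hS _ rfl)
  | orL Γ Δ A B =>
    have hΓ : ∀ D ∈ Γ, Entails C X (transl D) := fun D hD => hX D (Multiset.mem_cons_of_mem hD)
    exact (hX _ (Multiset.mem_cons_self _ _)).andE₁.orE
      (hP _ (Set.subset_insert _ _) (cons hΓ)) (hQ _ (Set.subset_insert _ _) (cons hΓ))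
  | impL Γ Δ A B =>
    have hΓ : ∀ D ∈ Γ, Entails C X (transl D) := fun D hD => hX D (Multiset.mem_cons_of_mem hD)
    exact ((hX _ (Multiset.mem_cons_self _ _)).andE₁.mp (hP X le_rfl hΓ)).cut
      (hQ _ (Set.subset_insert _ _) (cons hΓ))

namespace ProofTree

/-- All subtrees. -/
def nodes {α : Type} : ProofTree α → List (ProofTree α)
  | leaf S => [leaf S]
  | unary S π => unary S π :: π.nodes
  | binary S π₁ π₂ => binary S π₁ π₂ :: (π₁.nodes ++ π₂.nodes)

theorem self_mem_nodes {α : Type} (π : ProofTree α) : π ∈ π.nodes := by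
  cases π <;> simp [nodes]

end ProofTree

/-- The Horn formulas that the node contributes. -/
def LocalHorn (C : Set FmL) (H : FmL → List FmPlus) (ν : ProofTree ℕ) (F : FmPlus) : Prop :=
  ∃ D, ν.root.suc = some D ∧ (F = curry ν.root.ant (angled D) ∨
    ∃ A ∈ C, ∃ G ∈ H A, F = inst (fun p => Fm.matchAt p A D) G)

/-- Passing upwards through a modal rule consumes one box of every Horn formula, and the premise has
fewer nodes than the whole tree, so fewer boxes than nodes are enough. -/
theorem holds_of_isProof {H : FmL → List FmPlus}
    (hH : ∀ A ∈ C, ∀ (v : ℕ → FmL) (X : Set FmPlus), (∀ F ∈ H A, Entails C X (inst v F)) →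
      Entails C X (A.subst fun p => transl (v p)) → Entails C X (transl (A.subst v)))
    (τ : ProofTree ℕ) (hτ : τ.IsProof C) (X : Set FmPlus)
    (hX : ∀ ν ∈ τ.nodes, ∀ F, LocalHorn C H ν F → ∀ k < τ.nodes.length,
      Entails C X (Fm.box^[k] F)) : Holds C X τ.concl := by
  have suc : ∀ (τ : ProofTree ℕ) (X : Set FmPlus), (∀ ν ∈ τ.nodes, ∀ F, LocalHorn C H ν F →
      ∀ k < τ.nodes.length, Entails C X (Fm.box^[k] F)) →
      (∀ A ∈ τ.concl.ant, Entails C X (transl A)) →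
      ∀ D, τ.concl.suc = some D → Entails C X (angled D) := fun τ X hX hΓ D hD =>
    (hX τ τ.self_mem_nodes _ ⟨D, hD, Or.inl rfl⟩ 0
      (List.length_pos_of_mem τ.self_mem_nodes)).ofCurry fun A hA => (hΓ A hA).angled
  induction τ generalizing X with
  | leaf S =>
    intro hΓ
    refine Holds.ofAxiom hτ (suc _ X hX hΓ) (fun A hA v hv => ?_) hΓ
    -- The premise `A(φᵗ)` is itself an axiom over `𝓛⁺`; the matched substitution replaces `v`,
    -- since the node shows only its succedent.
    have h₁ := hH A hA (fun p => Fm.matchAt p A (A.subst v)) X (fun G hG =>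
      hX _ (by simp [ProofTree.nodes]) _ ⟨A.subst v, hv, Or.inr ⟨A, hA, G, hG, rfl⟩⟩ 0
        (by simp [ProofTree.nodes])) (Entails.ofMem hA _)
    rwa [Fm.subst_matchAt] at h₁
  | unary S π ih =>
    intro hΓ
    refine Holds.ofRule₁ hτ.2 (fun Y hY => ih hτ.1 Y fun ν hν F hF k hk => ?_)
      (fun Y hY => ih hτ.1 Y fun ν hν F hF k hk => .hyp (hY ?_)) (suc _ X hX hΓ) hΓ
    · exact (hX ν (by simp [ProofTree.nodes, hν]) F hF k
        (by simp only [ProofTree.nodes, List.length_cons]; omega)).mono hY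
    -- The extra node at the root pays for the extra box.
    · have := hX ν (by simp [ProofTree.nodes, hν]) F hF (k + 1)
        (by simp only [ProofTree.nodes, List.length_cons]; omega)
      rwa [Function.iterate_succ_apply'] at this
  | binary S π₁ π₂ ih₁ ih₂ =>
    intro hΓ
    refine Holds.ofRule₂ hτ.2.2 (fun Y hY => ih₁ hτ.1 Y fun ν hν F hF k hk => ?_)
      (fun Y hY => ih₂ hτ.2.1 Y fun ν hν F hF k hk => ?_) (suc _ X hX hΓ) hΓ
    · exact (hX ν (by simp [ProofTree.nodes, hν]) F hF k
        (by simp only [ProofTree.nodes, List.length_cons, List.length_append]; omega)).mono hY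
    · exact (hX ν (by simp [ProofTree.nodes, hν]) F hF k
        (by simp only [ProofTree.nodes, List.length_cons, List.length_append]; omega)).mono hY

theorem Holds.provable {M : Multiset FmPlus} {S : Sequent ℕ}
    (h : Holds C {F | F ∈ M + S.ant.map transl} S) :
    Provable C (⟨M + S.ant.map transl, S.suc.map transl⟩ : Sequent (ℕ ⊕ FmL)) := by
  have h' := (h fun A hA => .hyp (Multiset.mem_add.2 (Or.inr (Multiset.mem_map_of_mem _ hA)))).provable
    (M := M + S.ant.map transl) fun B hB => hB
  cases hS : S.suc with
  | none =>
    rw [hS] at h'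
    -- An empty succedent was read as `⊥`; the cut empties it again.
    exact .ofRule₂ (.cut _ _ .bot) h' (.ofAxiom (.botL _ _))
  | some D =>
    rw [hS] at h'
    exact h'

end Soundness

/-! ### Substitution in proofs -/

/-- Substitution in a written sequent. -/
def Line.subst {α β : Type} (v : α → Fm β) (S : Line α) : Line β :=
  ⟨S.ant.map (Fm.subst v), S.suc.map (Fm.subst v)⟩

/-- Substitution in a sequent. -/
def Sequent.subst {α β : Type} (v : α → Fm β) (S : Sequent α) : Sequent β :=
  ⟨S.ant.map (Fm.subst v), S.suc.map (Fm.subst v)⟩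

theorem IsAxiom.subst {α β : Type} {C : Set FmL} (v : α → Fm β) {S : Sequent α}
    (h : IsAxiom C S) : IsAxiom C (S.subst v) := by
  cases h with
  | id Γ A => simpa [Sequent.subst, Fm.subst] using IsAxiom.id (Γ.map (Fm.subst v)) (A.subst v)
  | botL Γ Δ =>
    simpa [Sequent.subst, Fm.subst] using IsAxiom.botL (Γ.map (Fm.subst v)) (Δ.map (Fm.subst v))
  | topR Γ => exact IsAxiom.topR (Γ.map (Fm.subst v))
  | ofMem A hA w =>
    have := IsAxiom.ofMem (α := β) A hA fun p => (w p).subst v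
    rwa [← subst_subst] at this

theorem map_box_subst {α β : Type} (v : α → Fm β) (Γ : Multiset (Fm α)) :
    (Γ.map Fm.box).map (Fm.subst v) = (Γ.map (Fm.subst v)).map Fm.box := by
  simp only [Multiset.map_map]
  rfl

theorem Rule₁.subst {α β : Type} (v : α → Fm β) {P S : Sequent α} (h : Rule₁ P S) :
    Rule₁ (P.subst v) (S.subst v) := by
  cases h with
  | weakL Γ Δ A => simpa [Sequent.subst, Fm.subst] using Rule₁.weakL (Γ.map (Fm.subst v)) _ (A.subst v)
  | weakR Γ A => exact Rule₁.weakR (Γ.map (Fm.subst v)) (A.subst v)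
  | contrL Γ Δ A => simpa [Sequent.subst, Fm.subst] using Rule₁.contrL (Γ.map (Fm.subst v)) _ (A.subst v)
  | andL₁ Γ Δ A B =>
    simpa [Sequent.subst, Fm.subst] using Rule₁.andL₁ (Γ.map (Fm.subst v)) _ (A.subst v) (B.subst v)
  | andL₂ Γ Δ A B =>
    simpa [Sequent.subst, Fm.subst] using Rule₁.andL₂ (Γ.map (Fm.subst v)) _ (A.subst v) (B.subst v)
  | orR₁ Γ A B => exact Rule₁.orR₁ (Γ.map (Fm.subst v)) (A.subst v) (B.subst v)
  | orR₂ Γ A B => exact Rule₁.orR₂ (Γ.map (Fm.subst v)) (A.subst v) (B.subst v)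
  | impR Γ A B =>
    simpa [Sequent.subst, Fm.subst] using Rule₁.impR (Γ.map (Fm.subst v)) (A.subst v) (B.subst v)
  | kBox Γ A =>
    simpa only [Sequent.subst, Fm.subst, Option.map_some, map_box_subst] using Rule₁.kBox (Γ.map (Fm.subst v)) (A.subst v)
  | kDia Γ A B =>
    simpa only [Sequent.subst, Fm.subst, Option.map_some, map_box_subst, Multiset.map_cons] using
      Rule₁.kDia (Γ.map (Fm.subst v)) (A.subst v) (B.subst v)

theorem Rule₂.subst {α β : Type} (v : α → Fm β) {P Q S : Sequent α} (h : Rule₂ P Q S) :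
    Rule₂ (P.subst v) (Q.subst v) (S.subst v) := by
  cases h with
  | cut Γ Δ A => simpa [Sequent.subst, Fm.subst] using Rule₂.cut (Γ.map (Fm.subst v)) _ (A.subst v)
  | andR Γ A B => exact Rule₂.andR (Γ.map (Fm.subst v)) (A.subst v) (B.subst v)
  | orL Γ Δ A B =>
    simpa [Sequent.subst, Fm.subst] using Rule₂.orL (Γ.map (Fm.subst v)) _ (A.subst v) (B.subst v)
  | impL Γ Δ A B =>
    simpa [Sequent.subst, Fm.subst] using Rule₂.impL (Γ.map (Fm.subst v)) _ (A.subst v) (B.subst v)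

namespace ProofTree

/-- Substitution in a proof. -/
def subst {α β : Type} (v : α → Fm β) : ProofTree α → ProofTree β
  | leaf S => leaf (S.subst v)
  | unary S π => unary (S.subst v) (π.subst v)
  | binary S π₁ π₂ => binary (S.subst v) (π₁.subst v) (π₂.subst v)

theorem root_subst {α β : Type} (v : α → Fm β) (π : ProofTree α) :
    (π.subst v).root = π.root.subst v := by
  cases π <;> rfl

theorem concl_subst {α β : Type} (v : α → Fm β) (π : ProofTree α) :
    (π.subst v).concl = π.concl.subst v := by
  rw [concl, root_subst]; rfl

theorem IsProof.subst {α β : Type} {C : Set FmL} (v : α → Fm β) {π : ProofTree α}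
    (h : π.IsProof C) : (π.subst v).IsProof C := by
  induction π with
  | leaf S => exact IsAxiom.subst v h
  | unary S π ih => exact ⟨ih h.1, by rw [concl_subst]; exact h.2.subst v⟩
  | binary S π₁ π₂ ih₁ ih₂ =>
    exact ⟨ih₁ h.1, ih₂ h.2.1, by rw [concl_subst, concl_subst]; exact h.2.2.subst v⟩

/-- The succedent of the end-sequent, `⊥` if it is empty. -/
def goal {α : Type} (π : ProofTree α) : Fm α := π.root.suc.getD .bot

/-- The standard substitution of the formula of a valid item is thereby read off its proof, so the
algorithm never has to compute it. -/
theorem goal_of_root {α : Type} {π : ProofTree α} {Γ : List (Fm α)} {D : Fm α}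
    (h : π.root = ⟨Γ, some D⟩) : π.goal = D := by
  rw [goal, h]; rfl

/-- The immediate subtrees. -/
def children {α : Type} : ProofTree α → List (ProofTree α)
  | leaf _ => []
  | unary _ π => [π]
  | binary _ π₁ π₂ => [π₁, π₂]

end ProofTree

/-! ### The algorithm -/

/-- An `𝓛⁺`-formula together with a proof of its standard substitution. -/
abbrev Item : Type := FmPlus × ProofTree ℕ

/-- The item consists of a Horn formula over angled atoms and a proof of its standard
substitution. -/
def Item.Valid (C : Set FmL) (x : Item) : Prop :=
  AngledHorn x.1 ∧ x.2.IsProof C ∧ x.2.root = ⟨[], some (stdSubst x.1)⟩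

/-- The conjunction of the items is proved by right conjunction rules. -/
def conjProof : List Item → ProofTree ℕ
  | [] => .leaf ⟨[], some .top⟩
  | [x] => x.2
  | x :: y :: I =>
      .binary ⟨[], some (.and x.2.goal (conjProof (y :: I)).goal)⟩ x.2 (conjProof (y :: I))

theorem conjProof_spec {C : Set FmL} {I : List Item} (hI : ∀ x ∈ I, Item.Valid C x) :
    (conjProof I).IsProof C ∧
      (conjProof I).root = ⟨[], some (Fm.conj ((I.map Prod.fst).map stdSubst))⟩ := by
  induction I with
  | nil => exact ⟨IsAxiom.topR 0, rfl⟩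
  | cons x I ih =>
    have hx := hI x (by simp)
    cases I with
    | nil => exact hx.2
    | cons y I =>
      obtain ⟨h₁, h₂⟩ := ih fun z hz => hI z (by simp [hz])
      rw [conjProof, ProofTree.goal_of_root hx.2.2, ProofTree.goal_of_root h₂]
      refine ⟨⟨hx.2.1, h₁, ?_⟩, rfl⟩
      rw [ProofTree.concl, ProofTree.concl, hx.2.2, h₂]
      exact Rule₂.andR 0 _ _

/-- Prefix an item with a box. -/
def boxItem (x : Item) : Item := (.box x.1, .unary ⟨[], some (.box x.2.goal)⟩ x.2)

theorem Item.Valid.boxItem {C : Set FmL} {x : Item} (hx : Item.Valid C x) :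
    Item.Valid C (boxItem x) := by
  rw [ModalHornTranslation.boxItem, ProofTree.goal_of_root hx.2.2]
  refine ⟨hx.1.box, ⟨hx.2.1, ?_⟩, rfl⟩
  rw [ProofTree.concl, hx.2.2]
  exact Rule₁.kBox 0 _

theorem Item.Valid.iterate_boxItem {C : Set FmL} {x : Item} (hx : Item.Valid C x) (k : ℕ) :
    Item.Valid C (ModalHornTranslation.boxItem^[k] x) := by
  induction k generalizing x with
  | zero => exact hx
  | succ k ih => exact ih hx.boxItem

theorem iterate_boxItem_fst (k : ℕ) (x : Item) : (boxItem^[k] x).1 = Fm.box^[k] x.1 := by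
  induction k generalizing x with
  | zero => rfl
  | succ k ih => simp only [Function.iterate_succ_apply, ih]; rfl

/-- Add an item to the list and prefix it with a box. -/
def boxLoop (s : Item × List Item) : Item × List Item := (boxItem s.1, s.1 :: s.2)

theorem iterate_boxLoop_fst (n : ℕ) (s : Item × List Item) :
    (boxLoop^[n] s).1 = boxItem^[n] s.1 := by
  induction n generalizing s with
  | zero => rfl
  | succ n ih => simp only [Function.iterate_succ_apply, ih]; rfl

theorem mem_iterate_boxLoop {n : ℕ} {s : Item × List Item} {y : Item} :
    y ∈ (boxLoop^[n] s).2 ↔ y ∈ s.2 ∨ ∃ k < n, y = boxItem^[k] s.1 := by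
  induction n with
  | zero => simp
  | succ n ih =>
    rw [Function.iterate_succ_apply']
    simp only [boxLoop, List.mem_cons, ih, iterate_boxLoop_fst, Nat.lt_succ_iff_lt_or_eq]
    constructor
    · rintro (h | h | ⟨k, hk, h⟩)
      · exact Or.inr ⟨n, Or.inr rfl, h⟩
      · exact Or.inl h
      · exact Or.inr ⟨k, Or.inl hk, h⟩
    · rintro (h | ⟨k, hk | rfl, h⟩)
      · exact Or.inr (Or.inl h)
      · exact Or.inr (Or.inr ⟨k, hk, h⟩)
      · exact Or.inl h

theorem length_iterate_boxLoop (n : ℕ) (s : Item × List Item) :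
    (boxLoop^[n] s).2.length = s.2.length + n := by
  induction n with
  | zero => rfl
  | succ n ih =>
    rw [Function.iterate_succ_apply']
    simp only [boxLoop, List.length_cons, ih]
    omega

/-- Add the item with up to `n - 1` boxes. -/
def addBoxes (n : ℕ) (x : Item) (I : List Item) : List Item := (boxLoop^[n] (x, I)).2

theorem mem_addBoxes {n : ℕ} {x y : Item} {I : List Item} :
    y ∈ addBoxes n x I ↔ y ∈ I ∨ ∃ k < n, y = boxItem^[k] x :=
  mem_iterate_boxLoop

/-- Move one formula of the antecedent to the right. -/
def curryLoop : List FmL × Item → List FmL × Item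
  | ([], x) => ([], x)
  | (A :: Γ, F, ρ) => (Γ, .imp (angled A) F, .unary ⟨Γ, some (.imp A ρ.goal)⟩ ρ)

/-- The item of the end-sequent of a proof. -/
def curryItem (n : ℕ) (τ : ProofTree ℕ) : Item :=
  (curryLoop^[n] (τ.root.ant, angled τ.goal, τ)).2

/-- The loop is stationary once the list is exhausted, so any upper bound for the length can serve
as counter. -/
theorem iterate_curryLoop {n : ℕ} {Γ : List FmL} (hn : Γ.length ≤ n) (x : Item) :
    (curryLoop^[n] (Γ, x)).2.1 = curry Γ x.1 := by
  induction n generalizing Γ x with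
  | zero => rw [List.eq_nil_of_length_eq_zero (Nat.le_zero.1 hn)]; rfl
  | succ n ih =>
    cases Γ with
    | nil => exact ih (Γ := []) (Nat.zero_le n) x
    | cons A Γ => exact ih (Nat.le_of_succ_le_succ hn) _

theorem valid_iterate_curryLoop {C : Set FmL} {n : ℕ} {Γ : List FmL} (hn : Γ.length ≤ n) {x : Item}
    (h₁ : AngledHorn x.1) (h₂ : x.2.IsProof C) (h₃ : x.2.root = ⟨Γ, some (stdSubst x.1)⟩) :
    Item.Valid C (curryLoop^[n] (Γ, x)).2 := by
  induction n generalizing Γ x with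
  | zero =>
    obtain rfl := List.eq_nil_of_length_eq_zero (Nat.le_zero.1 hn)
    exact ⟨h₁, h₂, h₃⟩
  | succ n ih =>
    cases Γ with
    | nil => exact ih (Γ := []) (Nat.zero_le n) h₁ h₂ h₃
    | cons A Γ =>
      have hg := ProofTree.goal_of_root h₃
      refine ih (Nat.le_of_succ_le_succ hn) (h₁.imp A) ⟨h₂, ?_⟩ ?_
      · rw [ProofTree.concl, h₃, hg]
        exact Rule₁.impR (Γ : Multiset FmL) _ _
      · rw [hg]
        rfl

/-- A pattern and an item that is to be instantiated by matching against the pattern. -/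
abbrev Template : Type := FmL × Item

/-- The instance of a template for an instance `D` of its pattern. -/
noncomputable def instItem (t : Template) (D : FmL) : Item :=
  (inst (fun p => Fm.matchAt p t.1 D) t.2.1, t.2.2.subst fun p => Fm.matchAt p t.1 D)

/-- `D` need not be an instance of the pattern: matching always returns some substitution, and
substitution preserves proofs. -/
theorem Item.Valid.instItem {C : Set FmL} {t : Template} (h : Item.Valid C t.2) (D : FmL) :
    Item.Valid C (instItem t D) := by
  refine ⟨h.1.inst _, h.2.1.subst _, ?_⟩
  simp only [ModalHornTranslation.instItem, ProofTree.root_subst, h.2.2, stdSubst_inst]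
  rfl

/-- Add the instances of the templates. -/
noncomputable def addTemplates (n : ℕ) (D : FmL) (L : List Template) (I : List Item) : List Item :=
  L.foldr (fun t J => addBoxes n (instItem t D) J) I

theorem mem_addTemplates {n : ℕ} {D : FmL} {L : List Template} {I : List Item} {y : Item} :
    y ∈ addTemplates n D L I ↔ y ∈ I ∨ ∃ t ∈ L, ∃ k < n, y = boxItem^[k] (instItem t D) := by
  induction L with
  | nil => simp [addTemplates]
  | cons t L ih =>
    have : addTemplates n D (t :: L) I = addBoxes n (instItem t D) (addTemplates n D L I) := rfl
    rw [this, mem_addBoxes, ih]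
    simp only [List.mem_cons, exists_eq_or_imp]
    rw [or_assoc, or_comm (b := ∃ k < n, _)]

theorem length_addTemplates (n : ℕ) (D : FmL) (L : List Template) (I : List Item) :
    (addTemplates n D L I).length = I.length + L.length * n := by
  induction L with
  | nil => simp [addTemplates]
  | cons t L ih =>
    have : addTemplates n D (t :: L) I = addBoxes n (instItem t D) (addTemplates n D L I) := rfl
    rw [this, addBoxes, length_iterate_boxLoop, ih, List.length_cons, Nat.succ_mul, Nat.add_assoc]

/-- Add the items of the last inference of a proof. -/
noncomputable def addNode (L : List Template) (n : ℕ) (τ : ProofTree ℕ) (I : List Item) :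
    List Item :=
  if τ.root.suc = none then I else
    addBoxes n (curryItem n τ) (addTemplates n τ.goal L I)

theorem mem_addNode {L : List Template} {n : ℕ} {τ : ProofTree ℕ} {I : List Item} {y : Item} :
    y ∈ addNode L n τ I ↔ y ∈ I ∨ τ.root.suc ≠ none ∧ ∃ k < n, y = boxItem^[k] (curryItem n τ) ∨
      ∃ t ∈ L, y = boxItem^[k] (instItem t τ.goal) := by
  unfold addNode
  split_ifs with h
  · simp [h]
  · simp only [mem_addBoxes, mem_addTemplates, ne_eq, h, not_false_eq_true, true_and]
    constructor
    · rintro ((h | ⟨t, ht, k, hk, h⟩) | ⟨k, hk, h⟩)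
      · exact Or.inl h
      · exact Or.inr ⟨k, hk, Or.inr ⟨t, ht, h⟩⟩
      · exact Or.inr ⟨k, hk, Or.inl h⟩
    · rintro (h | ⟨k, hk, h | ⟨t, ht, h⟩⟩)
      · exact Or.inl (Or.inl h)
      · exact Or.inr ⟨k, hk, h⟩
      · exact Or.inl (Or.inr ⟨t, ht, k, hk, h⟩)

theorem length_addNode_le (L : List Template) (n : ℕ) (τ : ProofTree ℕ) (I : List Item) :
    (addNode L n τ I).length ≤ I.length + (L.length + 1) * n := by
  unfold addNode
  split_ifs with h
  · omega
  · rw [addBoxes, length_iterate_boxLoop, length_addTemplates, Nat.succ_mul, Nat.add_assoc]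

/-- The size of the code of a proof. -/
def ProofTree.size (π : ProofTree ℕ) : ℕ := (codeTree codeNat π).size

/-- The state of the main loop: the input, the subtrees that are still to be treated and the
items that have been found. -/
abbrev WorkState : Type := ProofTree ℕ × List (ProofTree ℕ) × List Item

/-- Treat one subtree. -/
noncomputable def workLoop (L : List Template) : WorkState → WorkState
  | (π, [], I) => (π, [], I)
  | (π, τ :: W, I) => (π, τ.children ++ W, addNode L π.size τ I)

/-- All items of a proof. -/
noncomputable def items (L : List Template) (π : ProofTree ℕ) : List Item :=
  ((workLoop L)^[π.size] (π, [π], [])).2.2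

/-- The output of the algorithm. -/
noncomputable def output (L : List Template) (π : ProofTree ℕ) : List FmPlus × ProofTree ℕ :=
  ((items L π).map Prod.fst, conjProof (items L π))

/-! ### Traversal of the proof and correctness of the output -/

theorem ProofTree.nodes_eq {α : Type} (τ : ProofTree α) :
    τ.nodes = τ :: τ.children.flatMap ProofTree.nodes := by
  cases τ <;> simp [nodes, children]

/-- Each round removes exactly one node from the pending forest, so as many rounds as there are
pending nodes reach all of them. -/
theorem mem_workLoop {L : List Template} {π : ProofTree ℕ} {y : Item} (k : ℕ)
    (W : List (ProofTree ℕ)) (I : List Item) (hW : (W.map fun τ => τ.nodes.length).sum ≤ k)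
    (hy : y ∈ I ∨ ∃ τ ∈ W, ∃ ν ∈ τ.nodes, y ∈ addNode L π.size ν []) :
    y ∈ ((workLoop L)^[k] (π, W, I)).2.2 := by
  induction k generalizing W I with
  | zero =>
    rcases hy with hy | ⟨τ, hτ, -⟩
    · exact hy
    · have h₁ := List.single_le_sum (fun _ _ => Nat.zero_le _) _
        (List.mem_map_of_mem (f := fun τ : ProofTree ℕ => τ.nodes.length) hτ)
      have h₂ := List.length_pos_of_mem τ.self_mem_nodes
      omega
  | succ k ih =>
    rw [Function.iterate_succ_apply]
    cases W with
    | nil => exact ih [] I (Nat.zero_le k) (by simpa using hy)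
    | cons τ W =>
      refine ih (τ.children ++ W) _ ?_ ?_
      · rw [List.map_cons, List.sum_cons, τ.nodes_eq, List.length_cons, List.length_flatMap] at hW
        rw [List.map_append, List.sum_append]
        omega
      · simp only [mem_addNode, List.not_mem_nil, false_or] at hy ⊢
        rcases hy with hy | ⟨τ', hτ', ν, hν, hy⟩
        · exact Or.inl (Or.inl hy)
        · rcases List.mem_cons.1 hτ' with rfl | hτ'
          · rw [ProofTree.nodes_eq, List.mem_cons, List.mem_flatMap] at hν
            rcases hν with rfl | ⟨τ'', hτ'', hν⟩
            · exact Or.inl (Or.inr hy)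
            · exact Or.inr ⟨τ'', by simp [hτ''], ν, hν, hy⟩
          · exact Or.inr ⟨τ', by simp [hτ'], ν, hν, hy⟩

theorem length_le_size_codeList {β : Type} (c : β → SExp) (L : List β) :
    L.length ≤ (codeList c L).size := by
  induction L with
  | nil => simp
  | cons b L ih => simp only [codeList, SExp.size_cons, List.length_cons]; omega

theorem ProofTree.size_root_lt (τ : ProofTree ℕ) : (codeLine codeNat τ.root).size < τ.size := by
  cases τ <;> simp only [size, codeTree, SExp.size_cons, root] <;> omega

theorem ProofTree.length_ant_le (τ : ProofTree ℕ) : τ.root.ant.length ≤ τ.size := by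
  have h₁ := length_le_size_codeList (codeFm codeNat) τ.root.ant
  have h₂ := τ.size_root_lt
  simp only [codeLine, SExp.size_cons] at h₂
  omega

/-- This keeps the work list from growing when a tree is replaced by its children. -/
theorem ProofTree.sum_size_children (τ : ProofTree ℕ) :
    (codeList (codeTree codeNat) τ.children).size ≤ τ.size := by
  cases τ <;> simp only [size, children, codeList, codeTree, codeLine, SExp.tag, SExp.size_cons,
    SExp.size_nil] <;> have := SExp.one_le_size <;> grind

theorem size_le_size_codeList {β : Type} (c : β → SExp) {L : List β} {b : β} (hb : b ∈ L) :
    (c b).size < (codeList c L).size := by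
  induction L with
  | nil => simp at hb
  | cons a L ih =>
    simp only [codeList, SExp.size_cons]
    rcases List.mem_cons.1 hb with rfl | hb
    · omega
    · have := ih hb
      omega

theorem ProofTree.length_nodes_le (τ : ProofTree ℕ) : τ.nodes.length ≤ τ.size := by
  induction τ with
  | leaf S => exact SExp.one_le_size _
  | unary S π ih =>
    simp only [nodes, List.length_cons, size, codeTree, SExp.size_cons] at *
    omega
  | binary S π₁ π₂ ih₁ ih₂ =>
    simp only [nodes, List.length_cons, List.length_append, size, codeTree, SExp.size_cons] at *
    omega

theorem ProofTree.IsProof.children {α : Type} {C : Set FmL} {τ : ProofTree α} (h : τ.IsProof C) :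
    ∀ ν ∈ τ.children, ν.IsProof C := by
  cases τ with
  | leaf S => simp [ProofTree.children]
  | unary S π => simpa [ProofTree.children] using h.1
  | binary S π₁ π₂ => simpa [ProofTree.children] using ⟨h.1, h.2.1⟩

theorem ProofTree.root_of_suc {τ : ProofTree ℕ} (h : τ.root.suc ≠ none) :
    τ.root = ⟨τ.root.ant, some τ.goal⟩ := by
  obtain ⟨D, hD⟩ := Option.ne_none_iff_exists'.1 h
  rw [goal, hD]
  exact congrArg (Line.mk τ.root.ant) hD

theorem curryItem_valid {C : Set FmL} {n : ℕ} {τ : ProofTree ℕ} (hτ : τ.IsProof C)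
    (h : τ.root.suc ≠ none) (hn : τ.size ≤ n) : Item.Valid C (curryItem n τ) :=
  valid_iterate_curryLoop (τ.length_ant_le.trans hn) (.angled _) hτ (ProofTree.root_of_suc h)

/-- The size condition on pending trees guarantees that the common counter `π.size` is long enough
to curry each antecedent completely. -/
theorem valid_workLoop {C : Set FmL} {L : List Template} (hL : ∀ t ∈ L, Item.Valid C t.2)
    {π : ProofTree ℕ} (k : ℕ) (W : List (ProofTree ℕ)) (I : List Item)
    (hW : ∀ τ ∈ W, τ.IsProof C ∧ τ.size ≤ π.size) (hI : ∀ x ∈ I, Item.Valid C x) :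
    ∀ x ∈ ((workLoop L)^[k] (π, W, I)).2.2, Item.Valid C x := by
  induction k generalizing W I with
  | zero => exact hI
  | succ k ih =>
    rw [Function.iterate_succ_apply]
    cases W with
    | nil => exact ih [] I hW hI
    | cons τ W =>
      obtain ⟨hτ, hs⟩ := hW τ (by simp)
      refine ih _ _ (fun ν hν => ?_) fun x hx => ?_
      · rcases List.mem_append.1 hν with hν | hν
        · exact ⟨hτ.children ν hν, ((size_le_size_codeList (codeTree codeNat) hν).le.trans
            τ.sum_size_children).trans hs⟩
        · exact hW ν (by simp [hν])
      · rcases mem_addNode.1 hx with hx | ⟨h, k, -, rfl | ⟨t, ht, rfl⟩⟩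
        · exact hI x hx
        · exact (curryItem_valid hτ h hs).iterate_boxItem k
        · exact ((hL t ht).instItem _).iterate_boxItem k

theorem ProofTree.size_le_of_mem_nodes {π τ : ProofTree ℕ} (h : τ ∈ π.nodes) : τ.size ≤ π.size := by
  induction π with
  | leaf S => rw [List.mem_singleton.1 h]
  | unary S π ih =>
    rcases List.mem_cons.1 h with rfl | h
    · rfl
    · have := ih h
      simp only [size, codeTree, SExp.size_cons] at *
      omega
  | binary S π₁ π₂ ih₁ ih₂ =>
    rcases List.mem_cons.1 h with rfl | h
    · rfl
    · rcases List.mem_append.1 h with h | h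
      · have := ih₁ h
        simp only [size, codeTree, SExp.size_cons] at *
        omega
      · have := ih₂ h
        simp only [size, codeTree, SExp.size_cons] at *
        omega

/-- Correctness of the algorithm. -/
theorem output_spec {C : Set FmL} {H : FmL → List FmPlus} {L : List Template}
    (hH : ∀ A ∈ C, ∀ (v : ℕ → FmL) (X : Set FmPlus), (∀ F ∈ H A, Entails C X (inst v F)) →
      Entails C X (A.subst fun p => transl (v p)) → Entails C X (transl (A.subst v)))
    (hL : ∀ t ∈ L, Item.Valid C t.2) (hHL : ∀ A ∈ C, ∀ F ∈ H A, ∃ ρ, (A, F, ρ) ∈ L)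
    {π : ProofTree ℕ} (hπ : π.IsProof C) :
    Provable C (⟨((output L π).1 : Multiset FmPlus) + π.concl.ant.map transl,
      π.concl.suc.map transl⟩ : Sequent (ℕ ⊕ FmL)) ∧
    (∀ F ∈ (output L π).1, F.ModalHorn ∧ FromAngledAtoms F) ∧
    (output L π).2.IsProof C ∧
    (output L π).2.concl = ⟨0, some (Fm.conj ((output L π).1.map stdSubst))⟩ := by
  have hvalid : ∀ x ∈ items L π, Item.Valid C x :=
    valid_workLoop hL _ _ _ (by simpa using hπ) (by simp)
  refine ⟨Holds.provable (holds_of_isProof hH π hπ _ fun ν hν F hF k hk => .hyp ?_), ?_, ?_, ?_⟩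
  · have hk' : k < π.size := hk.trans_le π.length_nodes_le
    have hmem : ∀ y, y ∈ addNode L π.size ν [] → y ∈ items L π := fun y hy =>
      mem_workLoop _ _ _ (by simpa using π.length_nodes_le)
        (Or.inr ⟨π, List.mem_singleton_self π, ν, hν, hy⟩)
    obtain ⟨D, hD, hF⟩ := hF
    have hD' : ν.root.suc ≠ none := by simp [hD]
    have hg : ν.goal = D := by simp [ProofTree.goal, hD]
    refine Set.mem_ofPred.2 (Multiset.mem_add.2 (Or.inl ?_))
    rcases hF with rfl | ⟨A, hA, G, hG, rfl⟩
    · refine List.mem_map.2 ⟨_, hmem (boxItem^[k] (curryItem π.size ν))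
        (mem_addNode.2 (Or.inr ⟨hD', k, hk', Or.inl rfl⟩)), ?_⟩
      rw [iterate_boxItem_fst, curryItem, iterate_curryLoop, hg]
      exact ν.length_ant_le.trans (ProofTree.size_le_of_mem_nodes hν)
    · obtain ⟨ρ, hρ⟩ := hHL A hA G hG
      refine List.mem_map.2 ⟨_, hmem (boxItem^[k] (instItem (A, G, ρ) ν.goal))
        (mem_addNode.2 (Or.inr ⟨hD', k, hk', Or.inr ⟨_, hρ, rfl⟩⟩)), ?_⟩
      rw [iterate_boxItem_fst, instItem, hg]
  · intro F hF
    obtain ⟨x, hx, rfl⟩ := List.mem_map.1 hF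
    exact (hvalid x hx).1
  · exact (conjProof_spec hvalid).1
  · rw [ProofTree.concl, output, (conjProof_spec hvalid).2]
    rfl

open SExp

/-! ### The parts of the algorithm run in polynomial time -/

/-- The code of an item. -/
def codeItem (x : Item) : SExp := cons (codeFm codeAtomPlus x.1) (codeTree codeNat x.2)

/-- The code of a list of items: the list of their formulas and the proof of their conjunction. -/
def codeItems (I : List Item) : SExp :=
  cons (codeList (codeFm codeAtomPlus) (I.map Prod.fst)) (codeTree codeNat (conjProof I))

namespace PolyTime

variable {α : Type} {e : α → SExp}

theorem left {F : α → FmL} (hF : PolyTime e fun a => codeFm codeNat (F a)) :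
    PolyTime e fun a => codeFm codeNat (F a).left := by
  have bot := const e (codeFm codeNat .bot)
  refine (iteEq hF.hd (tag 0) bot (iteEq hF.hd (tag 1) bot (iteEq hF.hd (tag 2) bot
    (iteEq hF.hd (tag 6) hF.tl (iteEq hF.hd (tag 7) hF.tl hF.tl.hd))))).congr fun a => ?_
  cases F a <;> simp [codeFm, tag, Fm.left]

theorem right {F : α → FmL} (hF : PolyTime e fun a => codeFm codeNat (F a)) :
    PolyTime e fun a => codeFm codeNat (F a).right := by
  have bot := const e (codeFm codeNat .bot)
  refine (iteEq hF.hd (tag 3) hF.tl.tl (iteEq hF.hd (tag 4) hF.tl.tl (iteEq hF.hd (tag 5)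
    hF.tl.tl bot))).congr fun a => ?_
  cases F a <;> simp [codeFm, tag, Fm.right]

/-- The pattern is fixed, so the recursion along it unfolds into a fixed composition of programs.
The same applies to substitution into the fixed formulas and proofs of the templates. -/
theorem matchAt (p : ℕ) (A : FmL) {F : α → FmL} (hF : PolyTime e fun a => codeFm codeNat (F a)) :
    PolyTime e fun a => codeFm codeNat (Fm.matchAt p A (F a)) := by
  induction A generalizing F with
  | atom q => exact hF
  | bot => exact hF
  | top => exact hF
  | box A ih => exact ih hF.left
  | dia A ih => exact ih hF.left
  | and A B ihA ihB | or A B ihA ihB | imp A B ihA ihB =>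
    by_cases h : A.Occurs p
    · simpa only [Fm.matchAt, h, if_true] using ihA hF.left
    · simpa only [Fm.matchAt, h, if_false] using ihB hF.right

section Subst

variable {v : α → ℕ → FmL}

theorem fmSubst (hv : ∀ p, PolyTime e fun a => codeFm codeNat (v a p))
    (A : FmL) : PolyTime e fun a => codeFm codeNat (A.subst (v a)) := by
  induction A with
  | atom p => exact hv p
  | bot => exact const e _
  | top => exact const e _
  | and A B ihA ihB => exact (const e (tag 3)).cons (ihA.cons ihB)
  | or A B ihA ihB => exact (const e (tag 4)).cons (ihA.cons ihB)
  | imp A B ihA ihB => exact (const e (tag 5)).cons (ihA.cons ihB)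
  | box A ih => exact (const e (tag 6)).cons ih
  | dia A ih => exact (const e (tag 7)).cons ih

theorem instFm (hv : ∀ p, PolyTime e fun a => codeFm codeNat (v a p))
    (F : FmPlus) : PolyTime e fun a => codeFm codeAtomPlus (inst (v a) F) := by
  induction F with
  | atom x =>
    refine (const e (tag 0)).cons ((const e (tag 1)).cons ?_)
    cases x with
    | inl p => exact hv p
    | inr A => exact fmSubst hv A
  | bot => exact const e _
  | top => exact const e _
  | and A B ihA ihB => exact (const e (tag 3)).cons (ihA.cons ihB)
  | or A B ihA ihB => exact (const e (tag 4)).cons (ihA.cons ihB)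
  | imp A B ihA ihB => exact (const e (tag 5)).cons (ihA.cons ihB)
  | box A ih => exact (const e (tag 6)).cons ih
  | dia A ih => exact (const e (tag 7)).cons ih

theorem lineSubst (hv : ∀ p, PolyTime e fun a => codeFm codeNat (v a p))
    (S : Line ℕ) : PolyTime e fun a => codeLine codeNat (S.subst (v a)) := by
  obtain ⟨Γ, Δ⟩ := S
  refine cons (g := fun a => codeList (codeFm codeNat) (Γ.map (Fm.subst (v a))))
    (h := fun a => codeOption (codeFm codeNat) (Δ.map (Fm.subst (v a)))) ?_ ?_
  · induction Γ with
    | nil => exact const e _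
    | cons A Γ ih => exact (fmSubst hv A).cons ih
  · cases Δ with
    | none => exact const e _
    | some A => exact (const e nil).cons (fmSubst hv A)

theorem treeSubst (hv : ∀ p, PolyTime e fun a => codeFm codeNat (v a p))
    (ρ : ProofTree ℕ) : PolyTime e fun a => codeTree codeNat (ρ.subst (v a)) := by
  induction ρ with
  | leaf S => exact (const e (tag 0)).cons (lineSubst hv S)
  | unary S π ih => exact (const e (tag 1)).cons ((lineSubst hv S).cons ih)
  | binary S π₁ π₂ ih₁ ih₂ =>
    exact (const e (tag 2)).cons ((lineSubst hv S).cons (ih₁.cons ih₂))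

end Subst

theorem instItem (t : Template) {D : α → FmL} (hD : PolyTime e fun a => codeFm codeNat (D a)) :
    PolyTime e fun a => codeItem (instItem t (D a)) :=
  (instFm (v := fun a p => Fm.matchAt p t.1 (D a)) (fun p => hD.matchAt p t.1) t.2.1).cons
    (treeSubst (v := fun a p => Fm.matchAt p t.1 (D a)) (fun p => hD.matchAt p t.1) t.2.2)

theorem root {π : α → ProofTree ℕ} (hπ : PolyTime e fun a => codeTree codeNat (π a)) :
    PolyTime e fun a => codeLine codeNat (π a).root := by
  refine (iteEq hπ.hd (tag 0) hπ.tl hπ.tl.hd).congr fun a => ?_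
  cases π a <;> simp [codeTree, tag, ProofTree.root]

theorem goal {π : α → ProofTree ℕ} (hπ : PolyTime e fun a => codeTree codeNat (π a)) :
    PolyTime e fun a => codeFm codeNat (π a).goal := by
  refine (iteEq hπ.root.tl nil (const e (codeFm codeNat .bot)) hπ.root.tl.tl).congr fun a => ?_
  rcases h : (π a).root with ⟨Γ, _ | D⟩ <;> simp [codeLine, codeOption, ProofTree.goal, h]

theorem sucLine {Γ : α → List FmL} {D : α → FmL}
    (hΓ : PolyTime e fun a => codeList (codeFm codeNat) (Γ a))
    (hD : PolyTime e fun a => codeFm codeNat (D a)) :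
    PolyTime e fun a => codeLine codeNat ⟨Γ a, some (D a)⟩ :=
  hΓ.cons ((const e nil).cons hD)

theorem boxItem {x : α → Item} (hx : PolyTime e fun a => codeItem (x a)) :
    PolyTime e fun a => codeItem (boxItem (x a)) :=
  ((const e (tag 6)).cons hx.hd).cons ((const e (tag 1)).cons ((sucLine (Γ := fun _ => [])
    (D := fun a => .box (x a).2.goal) (const e nil) ((const e (tag 6)).cons
      (goal (π := fun a => (x a).2) hx.tl))).cons hx.tl))

/-- Since the code of a list of items already contains the proof of their conjunction, a new item
costs one inference on top of that proof, and no final assembly is needed. -/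
theorem consItem {x : α → Item} {I : α → List Item} (hx : PolyTime e fun a => codeItem (x a))
    (hI : PolyTime e fun a => codeItems (I a)) :
    PolyTime e fun a => codeItems (x a :: I a) := by
  have hg := goal (π := fun a => (x a).2) hx.tl
  have hg' := goal (π := fun a => conjProof (I a)) hI.tl
  refine (cons (hx.hd.cons hI.hd) (iteEq hI.hd nil hx.tl ((const e (tag 2)).cons
    ((sucLine (Γ := fun _ => []) (D := fun a => .and (x a).2.goal (conjProof (I a)).goal)
      (const e nil) ((const e (tag 3)).cons (hg.cons hg'))).cons (hx.tl.cons hI.tl))))).congr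
    fun a => ?_
  rcases I a with _ | ⟨y, J⟩ <;> simp [codeItems, codeItem, codeList, conjProof, codeTree]

end PolyTime

/-! ### Sizes -/

@[simp] theorem SExp.size_tag (n : ℕ) : (tag n).size = 2 * n + 1 := by
  induction n with
  | zero => rfl
  | succ n ih => simp only [tag, size_cons, size_nil, ih]; omega

/-- The `5` is the size of the code of `⊥`, the default for an empty succedent. -/
theorem size_goal_le (π : ProofTree ℕ) : (codeFm codeNat π.goal).size ≤ π.size + 5 := by
  have h := π.size_root_lt
  rcases hr : π.root with ⟨Γ, _ | D⟩
  · simp [ProofTree.goal, hr, codeFm]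
  · rw [hr] at h
    simp only [codeLine, codeOption, size_cons] at h
    simp only [ProofTree.goal, hr, Option.getD_some]
    omega

/-- Every box adds a line that repeats the whole goal, and the goal grows by `14` symbols each time,
so the growth is quadratic in `k`. The bound on the goal is carried along to make the induction
work. -/
theorem size_iterate_boxItem_le (k : ℕ) (x : Item) :
    (codeItem (boxItem^[k] x)).size ≤ (codeItem x).size + k * ((codeItem x).size + 14 * k + 60) ∧
    (codeFm codeNat (boxItem^[k] x).2.goal).size ≤ (codeItem x).size + 5 + 14 * k := by
  induction k with
  | zero =>
    have := size_goal_le x.2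
    simp only [codeItem, ProofTree.size, size_cons, Function.iterate_zero, id_eq] at *
    omega
  | succ k ih =>
    rw [Function.iterate_succ_apply']
    obtain ⟨h₁, h₂⟩ := ih
    generalize boxItem^[k] x = y at *
    have h₃ : (codeItem (boxItem y)).size
        = (codeItem y).size + (codeFm codeNat y.2.goal).size + 37 := by
      simp only [codeItem, boxItem, codeFm, codeTree, codeLine, codeList, codeOption, size_cons,
        size_tag, size_nil]
      omega
    have h₄ : (codeFm codeNat (boxItem y).2.goal).size = (codeFm codeNat y.2.goal).size + 14 := by
      simp only [boxItem, ProofTree.goal, ProofTree.root, Option.getD_some, codeFm, size_cons,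
        size_tag]
      omega
    constructor
    · rw [h₃]; nlinarith
    · rw [h₄]; omega

/-- A bound for the size of the code of `n` items of size at most `M`. -/
theorem size_codeItems_le {I : List Item} {M : ℕ} (hI : ∀ x ∈ I, (codeItem x).size ≤ M) :
    (codeItems I).size ≤
      I.length * (M + 1) + 2 + (I.length + 1) * (M + I.length * (M + 20) + 60) := by
  have h₁ : (codeList (codeFm codeAtomPlus) (I.map Prod.fst)).size ≤ I.length * (M + 1) + 1 := by
    induction I with
    | nil => simp [codeList]
    | cons x I ih =>
      have h := hI x (by simp)
      have := ih fun y hy => hI y (by simp [hy])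
      simp only [codeItem, size_cons] at h
      simp only [List.map_cons, codeList, size_cons, List.length_cons, Nat.succ_mul]
      omega
  -- Each inference repeats the conjunction of the remaining formulas; its linear bound must be
  -- carried through the induction to give the quadratic one for the proof.
  have h₂ : (codeFm codeNat (conjProof I).goal).size ≤ I.length * (M + 20) + 20 ∧
      (codeTree codeNat (conjProof I)).size ≤
        (I.length + 1) * (M + I.length * (M + 20) + 60) := by
    clear h₁
    induction I with
    | nil =>
      simp [conjProof, ProofTree.goal, ProofTree.root, codeFm, codeTree, codeLine, codeList,
        codeOption]
    | cons x I ih =>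
      have hx := hI x (by simp)
      have hg := size_goal_le x.2
      simp only [codeItem, size_cons] at hx
      simp only [ProofTree.size] at hg
      cases I with
      | nil =>
        simp only [conjProof, List.length_cons, List.length_nil]
        constructor <;> omega
      | cons y I =>
        obtain ⟨h₁, h₂⟩ := ih fun y hy => hI y (by simp [hy])
        have hgoal : (conjProof (x :: y :: I)).goal
            = .and x.2.goal (conjProof (y :: I)).goal := rfl
        rw [hgoal, conjProof, List.length_cons]
        generalize (y :: I).length = n at *
        simp only [codeFm, codeTree, codeLine, codeList, codeOption, size_cons, size_tag, size_nil]
        have hn : (n + 1) * (M + 20) = n * (M + 20) + (M + 20) := by ring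
        constructor
        · omega
        · rw [hn]
          nlinarith
  simp only [codeItems, size_cons]
  omega

theorem length_le_size_codeItems (I : List Item) : I.length ≤ (codeItems I).size := by
  have := length_le_size_codeList (codeFm codeAtomPlus) (I.map Prod.fst)
  rw [List.length_map] at this
  simp only [codeItems, size_cons]
  omega

theorem size_le_size_codeItems {I : List Item} {x : Item} (hx : x ∈ I) :
    (codeItem x).size ≤ (codeItems I).size := by
  have h₁ := size_le_size_codeList (codeFm codeAtomPlus) (List.mem_map_of_mem (f := Prod.fst) hx)
  have h₂ : (codeTree codeNat x.2).size ≤ (codeTree codeNat (conjProof I)).size := by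
    clear h₁
    induction I with
    | nil => simp at hx
    | cons y I ih =>
      cases I with
      | nil => rw [List.mem_singleton.1 hx]; rfl
      | cons z I =>
        simp only [conjProof, codeTree, size_cons]
        rcases List.mem_cons.1 hx with rfl | hx
        · omega
        · have := ih hx
          omega
  simp only [codeItems, codeItem, size_cons]
  omega

/-- A formula only moves from the list into an implication, so the combined size of list and goal
grows by a constant per round, and likewise that of list and Horn formula. The line added to the
proof is bounded by the former sum. -/
theorem size_curryLoop_le (s : List FmL × Item) :
    (codeList (codeFm codeNat) (curryLoop s).1).size
      + (codeFm codeAtomPlus (curryLoop s).2.1).size ≤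
      (codeList (codeFm codeNat) s.1).size + (codeFm codeAtomPlus s.2.1).size + 18 ∧
    (codeList (codeFm codeNat) (curryLoop s).1).size
      + (codeFm codeNat (curryLoop s).2.2.goal).size ≤
      (codeList (codeFm codeNat) s.1).size + (codeFm codeNat s.2.2.goal).size + 12 ∧
    (curryLoop s).2.2.size ≤ s.2.2.size + (codeList (codeFm codeNat) (curryLoop s).1).size
      + (codeFm codeNat (curryLoop s).2.2.goal).size + 8 := by
  obtain ⟨_ | ⟨A, Γ⟩, F, ρ⟩ := s
  · simp only [curryLoop]
    omega
  · have hgoal : (curryLoop (A :: Γ, F, ρ)).2.2.goal = .imp A ρ.goal := rfl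
    rw [hgoal]
    simp only [curryLoop, angled, codeFm, codeAtomPlus, codeList, ProofTree.size, codeTree,
      codeLine, codeOption, size_cons, size_tag, size_nil]
    omega

/-- The code of a state of the loop `curryLoop`. -/
def codeCurry (s : List FmL × Item) : SExp :=
  cons (codeList (codeFm codeNat) s.1) (codeItem s.2)

theorem size_iterate_curryLoop_le (k : ℕ) (s : List FmL × Item) :
    (codeCurry (curryLoop^[k] s)).size ≤
      3 * (codeCurry s).size + 30 * k + 20 + k * ((codeCurry s).size + 12 * k + 30) := by
  have h : (codeList (codeFm codeNat) (curryLoop^[k] s).1).size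
      + (codeFm codeAtomPlus (curryLoop^[k] s).2.1).size ≤ (codeCurry s).size + 18 * k ∧
    (codeList (codeFm codeNat) (curryLoop^[k] s).1).size
      + (codeFm codeNat (curryLoop^[k] s).2.2.goal).size ≤ (codeCurry s).size + 5 + 12 * k ∧
    (curryLoop^[k] s).2.2.size ≤
      (codeCurry s).size + k * ((codeCurry s).size + 12 * k + 30) := by
    induction k with
    | zero =>
      have := size_goal_le s.2.2
      simp only [codeCurry, codeItem, ProofTree.size, size_cons, Function.iterate_zero, id_eq] at *
      omega
    | succ k ih =>
      rw [Function.iterate_succ_apply']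
      have := size_curryLoop_le (curryLoop^[k] s)
      obtain ⟨h₁, h₂, h₃⟩ := ih
      refine ⟨by omega, by omega, ?_⟩
      nlinarith
  obtain ⟨h₁, h₂, h₃⟩ := h
  rw [codeCurry, codeItem, size_cons, size_cons]
  simp only [ProofTree.size] at h₃
  omega

/-- The code of a state of the loop `boxLoop`. -/
def codeBox (s : Item × List Item) : SExp := cons (codeItem s.1) (codeItems s.2)

/-- A bound for the size of the states of `boxLoop`. -/
theorem size_iterate_boxLoop_le {N k : ℕ} {s : Item × List Item} (hs : (codeBox s).size ≤ N)
    (hk : k ≤ N) :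
    (codeBox (boxLoop^[k] s)).size ≤ (N + N * (15 * N + 60)) + 1 +
      ((N + N) * ((N + N * (15 * N + 60)) + 1) + 2 + ((N + N) + 1) *
        ((N + N * (15 * N + 60)) + (N + N) * ((N + N * (15 * N + 60)) + 20) + 60)) := by
  simp only [codeBox, size_cons] at hs
  have hM : ∀ j ≤ N, (codeItem (boxItem^[j] s.1)).size ≤ N + N * (15 * N + 60) := fun j hj => by
    refine (size_iterate_boxItem_le j s.1).1.trans (Nat.add_le_add (by omega) ?_)
    exact Nat.mul_le_mul hj (by omega)
  have hI : ∀ y ∈ (boxLoop^[k] s).2, (codeItem y).size ≤ N + N * (15 * N + 60) := fun y hy => by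
    rcases mem_iterate_boxLoop.1 hy with hy | ⟨j, hj, rfl⟩
    · have := size_le_size_codeItems hy
      omega
    · exact hM j (by omega)
  have hlen : (boxLoop^[k] s).2.length ≤ N + N := by
    rw [length_iterate_boxLoop]
    have := length_le_size_codeItems s.2
    omega
  have h₁ := size_codeItems_le hI
  have h₂ := hM k hk
  rw [← iterate_boxLoop_fst] at h₂
  simp only [codeBox, size_cons]
  generalize N + N * (15 * N + 60) = M at *
  have h₃ : (boxLoop^[k] s).2.length * (M + 1) + 2 + ((boxLoop^[k] s).2.length + 1) *
      (M + (boxLoop^[k] s).2.length * (M + 20) + 60) ≤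
      (N + N) * (M + 1) + 2 + (N + N + 1) * (M + (N + N) * (M + 20) + 60) := by
    gcongr
  omega

namespace PolyTime

variable {α : Type} {e : α → SExp}

theorem size_le {g : α → SExp} (hg : PolyTime e g) :
    ∃ p : Polynomial ℕ, ∀ a, (g a).size ≤ p.eval (e a).size := by
  obtain ⟨c, p, h⟩ := hg
  exact ⟨p, fun a => (h a).1⟩

theorem addBoxes {x : α → Item} {I : α → List Item} {cnt : α → SExp} (hc : PolyTime e cnt)
    (hx : PolyTime e fun a => codeItem (x a)) (hI : PolyTime e fun a => codeItems (I a)) :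
    PolyTime e fun a => codeItems (addBoxes (cnt a).size (x a) (I a)) := by
  have hs : PolyTime e fun a => codeBox (x a, I a) := hx.cons hI
  obtain ⟨p, hp⟩ := hs.size_le
  obtain ⟨q, hq⟩ := hc.size_le
  have hstep : PolyTime codeBox fun s => codeBox (boxLoop s) :=
    (boxItem (refl codeBox).hd).cons (consItem (refl codeBox).hd (refl codeBox).tl)
  -- `Q` dominates both the initial state and the number of rounds, and `R` a single item with all
  -- its boxes.
  let Q : Polynomial ℕ := p + q
  let R : Polynomial ℕ := Q + Q * (15 * Q + 60)
  refine (iterate hstep hc hs (R + 1 + ((Q + Q) * (R + 1) + 2 + ((Q + Q) + 1) *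
    (R + (Q + Q) * (R + 20) + 60))) fun a k hk => ?_).tl
  have hN : (codeBox (x a, I a)).size ≤ Q.eval (e a).size := by
    rw [Polynomial.eval_add]
    exact (hp a).trans (Nat.le_add_right _ _)
  have hk' : k ≤ Q.eval (e a).size := by
    rw [Polynomial.eval_add]
    exact (hk.trans (hq a)).trans (Nat.le_add_left _ _)
  simpa only [R, Polynomial.eval_add, Polynomial.eval_mul, Polynomial.eval_ofNat,
    Polynomial.eval_one] using size_iterate_boxLoop_le hN hk'

theorem curryLoop : PolyTime codeCurry fun s => codeCurry (curryLoop s) := by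
  have h := refl codeCurry
  have hg : PolyTime codeCurry fun s => codeFm codeNat s.2.2.goal := goal h.tl.tl
  have hA := h.hd.hd
  refine (iteEq h.hd nil h (h.hd.tl.cons (((const _ (tag 5)).cons (((const _ (tag 0)).cons
    ((const _ (tag 1)).cons hA)).cons h.tl.hd)).cons ((const _ (tag 1)).cons ((h.hd.tl.cons
      ((const _ nil).cons ((const _ (tag 5)).cons (hA.cons hg)))).cons h.tl.tl))))).congr
    fun s => ?_
  obtain ⟨_ | ⟨A, Γ⟩, F, ρ⟩ := s
  · simp [codeCurry, codeList, ModalHornTranslation.curryLoop]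
  · simp [codeCurry, codeItem, codeList, codeFm, codeAtomPlus, angled, codeTree, codeLine,
      codeOption, ModalHornTranslation.curryLoop]

theorem curryItem {τ : α → ProofTree ℕ} {cnt : α → SExp} (hc : PolyTime e cnt)
    (hτ : PolyTime e fun a => codeTree codeNat (τ a)) :
    PolyTime e fun a => codeItem (curryItem (cnt a).size (τ a)) := by
  have hs : PolyTime e fun a => codeCurry ((τ a).root.ant, angled (τ a).goal, τ a) :=
    hτ.root.hd.cons (((const e (tag 0)).cons ((const e (tag 1)).cons hτ.goal)).cons hτ)
  obtain ⟨p, hp⟩ := hs.size_le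
  obtain ⟨q, hq⟩ := hc.size_le
  refine (iterate curryLoop hc hs (3 * p + 30 * q + 20 + q * (p + 12 * q + 30))
    fun a k hk => ?_).tl
  have hk := hk.trans (hq a)
  have hp := hp a
  refine (size_iterate_curryLoop_le k _).trans ?_
  simp only [Polynomial.eval_add, Polynomial.eval_mul, Polynomial.eval_ofNat]
  gcongr

theorem addTemplates (L : List Template) {D : α → FmL} {I : α → List Item} {cnt : α → SExp}
    (hc : PolyTime e cnt) (hD : PolyTime e fun a => codeFm codeNat (D a))
    (hI : PolyTime e fun a => codeItems (I a)) :
    PolyTime e fun a => codeItems (addTemplates (cnt a).size (D a) L (I a)) := by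
  induction L with
  | nil => exact hI
  | cons t L ih => exact addBoxes hc (hD.instItem t) ih

theorem addNode (L : List Template) {τ : α → ProofTree ℕ} {I : α → List Item} {cnt : α → SExp}
    (hc : PolyTime e cnt) (hτ : PolyTime e fun a => codeTree codeNat (τ a))
    (hI : PolyTime e fun a => codeItems (I a)) :
    PolyTime e fun a => codeItems (addNode L (cnt a).size (τ a) (I a)) := by
  refine (iteEq hτ.root.tl nil hI (addBoxes hc (curryItem hc hτ)
    (addTemplates L hc hτ.goal hI))).congr fun a => ?_
  rcases h : (τ a).root with ⟨Γ, _ | D⟩ <;>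
    simp [codeLine, codeOption, ModalHornTranslation.addNode, h]

end PolyTime

/-! ### The main loop -/

/-- The code of a state of the main loop. -/
def codeWork (s : WorkState) : SExp :=
  cons (codeTree codeNat s.1) (cons (codeList (codeTree codeNat) s.2.1) (codeItems s.2.2))

theorem codeList_append_size {β : Type} (c : β → SExp) (L M : List β) :
    (codeList c (L ++ M)).size + 1 = (codeList c L).size + (codeList c M).size := by
  induction L with
  | nil => simp [codeList]; omega
  | cons b L ih => simp only [List.cons_append, codeList, size_cons] at *; omega

namespace PolyTime

variable {α : Type} {e : α → SExp}

theorem childrenAppend {τ : α → ProofTree ℕ} {W : α → List (ProofTree ℕ)}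
    (hτ : PolyTime e fun a => codeTree codeNat (τ a))
    (hW : PolyTime e fun a => codeList (codeTree codeNat) (W a)) :
    PolyTime e fun a => codeList (codeTree codeNat) ((τ a).children ++ W a) := by
  refine (iteEq hτ.hd (tag 0) hW (iteEq hτ.hd (tag 1) (hτ.tl.tl.cons hW)
    (hτ.tl.tl.hd.cons (hτ.tl.tl.tl.cons hW)))).congr fun a => ?_
  cases τ a <;> simp [codeTree, tag, ProofTree.children, codeList]

theorem workLoop (L : List Template) : PolyTime codeWork fun s => codeWork (workLoop L s) := by
  have h := refl codeWork
  -- The default leaf only makes the expression total; it occurs in a branch that is not taken when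
  -- the work list is empty.
  let head : WorkState → ProofTree ℕ := fun s => s.2.1.headD (.leaf ⟨[], none⟩)
  let tail : WorkState → List (ProofTree ℕ) := fun s => s.2.1.tail
  have hhead : PolyTime codeWork fun s => codeTree codeNat (head s) := by
    refine (iteEq h.tl.hd nil (const _ (codeTree codeNat (.leaf ⟨[], none⟩))) h.tl.hd.hd).congr
      fun s => ?_
    rcases s with ⟨π, _ | ⟨τ, W⟩, I⟩ <;> simp [codeWork, codeList, head]
  have htail : PolyTime codeWork fun s => codeList (codeTree codeNat) (tail s) := by
    refine h.tl.hd.tl.congr fun s => ?_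
    rcases s with ⟨π, _ | ⟨τ, W⟩, I⟩ <;> simp [codeWork, codeList, tail, SExp.tl]
  have hnode := addNode L (τ := head) (I := fun s => s.2.2) h.hd hhead h.tl.tl
  refine (iteEq h.tl.hd nil h (h.hd.cons ((childrenAppend hhead htail).cons hnode))).congr
    fun s => ?_
  rcases s with ⟨π, _ | ⟨τ, W⟩, I⟩ <;>
    simp [codeWork, codeList, head, tail, ModalHornTranslation.workLoop, ProofTree.size]

end PolyTime

/-- Polynomial time includes a polynomial size bound for each template, and there are finitely many
to add up. -/
theorem exists_size_instItem_le (L : List Template) : ∃ p : Polynomial ℕ, ∀ t ∈ L, ∀ D,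
    (codeItem (instItem t D)).size ≤ p.eval (codeFm codeNat D).size := by
  induction L with
  | nil => exact ⟨0, by simp⟩
  | cons t L ih =>
    obtain ⟨p, hp⟩ := ih
    obtain ⟨q, hq⟩ := (PolyTime.instItem t (D := id) (PolyTime.refl (codeFm codeNat))).size_le
    refine ⟨p + q, fun s hs D => ?_⟩
    rw [Polynomial.eval_add]
    rcases List.mem_cons.1 hs with rfl | hs
    · exact (hq D).trans (Nat.le_add_left _ _)
    · exact (hp s hs D).trans (Nat.le_add_right _ _)

/-- A bound for the size of the items of a node. -/
theorem exists_size_addNode_le (L : List Template) : ∃ p : Polynomial ℕ, ∀ (π τ : ProofTree ℕ),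
    τ.size ≤ π.size → ∀ x ∈ addNode L π.size τ [], (codeItem x).size ≤ p.eval π.size := by
  obtain ⟨p, hp⟩ := exists_size_instItem_le L
  have h := PolyTime.refl fun s : ProofTree ℕ × ProofTree ℕ =>
    cons (codeTree codeNat s.1) (codeTree codeNat s.2)
  obtain ⟨q, hq⟩ := (PolyTime.curryItem (τ := Prod.snd) h.hd h.tl).size_le
  -- `M` bounds an item before boxing: `X + 5` bounds the goal matched by a template, and `2X + 1`
  -- the code of the pair of `π` and a subtree.
  let M : Polynomial ℕ := p.comp (Polynomial.X + 5) + q.comp (2 * Polynomial.X + 1)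
  refine ⟨M + Polynomial.X * (M + 14 * Polynomial.X + 60), fun π τ hτ x hx => ?_⟩
  have hM : ∀ y : Item, (codeItem y).size ≤ M.eval π.size → ∀ k < π.size,
      (codeItem (boxItem^[k] y)).size ≤
        (M + Polynomial.X * (M + 14 * Polynomial.X + 60)).eval π.size := fun y hy k hk => by
    refine (size_iterate_boxItem_le k y).1.trans ?_
    simp only [Polynomial.eval_add, Polynomial.eval_mul, Polynomial.eval_ofNat, Polynomial.eval_X]
      at hy ⊢
    gcongr
  rcases mem_addNode.1 hx with hx | ⟨-, k, hk, rfl | ⟨t, ht, rfl⟩⟩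
  · simp at hx
  · refine hM _ ?_ k hk
    simp only [M, Polynomial.eval_add, Polynomial.eval_comp, Polynomial.eval_mul,
      Polynomial.eval_ofNat, Polynomial.eval_X, Polynomial.eval_one]
    refine le_trans (hq (π, τ)) (le_trans (polynomial_eval_mono q ?_) (Nat.le_add_left _ _))
    simp only [size_cons]
    simp only [ProofTree.size] at hτ ⊢
    omega
  · refine hM _ ?_ k hk
    simp only [M, Polynomial.eval_add, Polynomial.eval_comp, Polynomial.eval_mul,
      Polynomial.eval_ofNat, Polynomial.eval_X, Polynomial.eval_one]
    refine le_trans (hp t ht _) (le_trans (polynomial_eval_mono p ?_) (Nat.le_add_right _ _))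
    have := size_goal_le τ
    omega

/-- The invariant of the main loop. -/
theorem workLoop_invariant {L : List Template} {π : ProofTree ℕ} {M : ℕ}
    (hM : ∀ τ : ProofTree ℕ, τ.size ≤ π.size → ∀ x ∈ addNode L π.size τ [], (codeItem x).size ≤ M)
    (k : ℕ) :
    ((ModalHornTranslation.workLoop L)^[k] (π, [π], [])).1 = π ∧
    (codeList (codeTree codeNat) ((workLoop L)^[k] (π, [π], [])).2.1).size ≤ π.size + 2 ∧
    (∀ τ ∈ ((workLoop L)^[k] (π, [π], [])).2.1, τ.size ≤ π.size) ∧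
    ((workLoop L)^[k] (π, [π], [])).2.2.length ≤ k * ((L.length + 1) * π.size) ∧
    ∀ x ∈ ((workLoop L)^[k] (π, [π], [])).2.2, (codeItem x).size ≤ M := by
  induction k with
  | zero => simp [codeList, ProofTree.size]
  | succ k ih =>
    rw [Function.iterate_succ_apply']
    generalize (workLoop L)^[k] (π, [π], []) = w at ih ⊢
    obtain ⟨π', W, I⟩ := w
    obtain ⟨h₁, h₂, h₃, h₄, h₅⟩ := ih
    obtain rfl : π' = π := h₁
    dsimp only at h₂ h₃ h₄ h₅ ⊢
    rw [Nat.add_one_mul]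
    cases W with
    | nil => exact ⟨rfl, h₂, h₃, by simp only [workLoop]; omega, h₅⟩
    | cons τ W =>
      have hτ := h₃ τ (by simp)
      have hs := τ.sum_size_children
      refine ⟨rfl, ?_, fun ν hν => ?_, ?_, fun x hx => ?_⟩
      · have := codeList_append_size (codeTree codeNat) τ.children W
        simp only [workLoop, codeList, size_cons, ProofTree.size] at *
        omega
      · rcases List.mem_append.1 hν with hν | hν
        · exact ((size_le_size_codeList (codeTree codeNat) hν).le.trans hs).trans hτ
        · exact h₃ ν (by simp [hν])
      · exact (length_addNode_le L _ τ I).trans (Nat.add_le_add_right h₄ _)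
      · rcases mem_addNode.1 hx with hx | hx
        · exact h₅ x hx
        · exact hM τ hτ x (mem_addNode.2 (Or.inr hx))

/-- The algorithm runs in polynomial time. -/
theorem polyTime_items (L : List Template) :
    PolyTime (codeTree codeNat) fun π => codeItems (items L π) := by
  obtain ⟨M, hM⟩ := exists_size_addNode_le L
  have h := PolyTime.refl (codeTree codeNat)
  have hs : PolyTime (codeTree codeNat) fun π => codeWork (π, [π], []) :=
    h.cons ((h.cons (PolyTime.const _ nil)).cons (PolyTime.const _ (codeItems [])))
  -- At most `π.size` rounds, each adding the curried formula and one instance per template with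
  -- fewer than `π.size` boxes.
  let N : Polynomial ℕ := Polynomial.X * (Polynomial.C (L.length + 1) * Polynomial.X)
  refine (PolyTime.iterate (PolyTime.workLoop L) h hs (2 * Polynomial.X + 10 +
    (N * (M + 1) + 2 + (N + 1) * (M + N * (M + 20) + 60))) fun π k hk => ?_).tl.tl
  obtain ⟨h₁, h₂, -, h₄, h₅⟩ := workLoop_invariant (hM π) k
  have h₆ := size_codeItems_le h₅
  have hN : ((workLoop L)^[k] (π, [π], [])).2.2.length ≤ N.eval π.size := by
    simp only [N, Polynomial.eval_mul, Polynomial.eval_X, Polynomial.eval_C]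
    exact h₄.trans (Nat.mul_le_mul_right _ hk)
  have h₇ := h₆.trans (show _ ≤ N.eval π.size * (M.eval π.size + 1) + 2 + (N.eval π.size + 1) *
    (M.eval π.size + N.eval π.size * (M.eval π.size + 20) + 60) by gcongr)
  simp only [codeWork, size_cons, h₁, Polynomial.eval_add, Polynomial.eval_mul,
    Polynomial.eval_ofNat, Polynomial.eval_one, Polynomial.eval_X]
  simp only [ProofTree.size] at *
  omega

/-! ### Assembly: the machine and its finite table of templates -/

/-- The code of the items is by definition the code of the output, so the program for `items`, run
at register `0` with all others empty, is already the required one. -/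
theorem computable_output (C : Set FmL) (L : List Template) :
    Nonempty (Turing.TM2ComputableInPolyTime encodeProof encodeOutput
      fun π : GProof C => output L π.1) := by
  obtain ⟨c, p, h⟩ := (polyTime_items L).comap (fun π : GProof C => π.1)
  exact Cmd.computableInPolyTime _ _ _ (c 0) p fun π => (h π).2 0 (fun _ => []) fun _ _ => rfl

theorem subst_atom (A : FmL) : A.subst Fm.atom = A := by
  induction A <;> simp_all [Fm.subst]

/-- Finitely many templates suffice for finitely many constructive formulas. -/
theorem exists_templates {C : Set FmL} (hfin : C.Finite) (hC : ∀ A ∈ C, A.Constructive) :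
    ∃ (H : FmL → List FmPlus) (L : List Template),
      (∀ A ∈ C, ∀ (v : ℕ → FmL) (X : Set FmPlus), (∀ F ∈ H A, Entails C X (inst v F)) →
        Entails C X (A.subst fun p => transl (v p)) → Entails C X (transl (A.subst v))) ∧
      (∀ t ∈ L, Item.Valid C t.2) ∧ ∀ A ∈ C, ∀ F ∈ H A, ∃ ρ, (A, F, ρ) ∈ L := by
  have key : ∀ A : FmL, ∃ H : List FmPlus, A ∈ C → (∀ F ∈ H, ∃ ρ, Item.Valid C (F, ρ)) ∧
      ∀ (v : ℕ → FmL) (X : Set FmPlus), (∀ F ∈ H, Entails C X (inst v F)) →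
        Entails C X (A.subst fun p => transl (v p)) → Entails C X (transl (A.subst v)) := by
    intro A
    by_cases hA : A ∈ C
    · obtain ⟨H, hH, h⟩ := RelTranslFromSubst.ofConstructive (C := C) (hC A hA)
      refine ⟨H, fun _ => ⟨fun F hF => ?_, h⟩⟩
      -- `A` is an axiom under the identity substitution, so Horn formulas that follow from `A`
      -- become provable outright.
      have hself : Entails C ∅ A := by
        have := Entails.ofMem (X := (∅ : Set FmL)) hA Fm.atom
        rwa [subst_atom] at this
      obtain ⟨ρ, hρ, hc⟩ := ((hH F hF).2.cutSet (X := ∅) (by rintro _ rfl; exact hself)).provable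
        (M := 0) (by simp)
      refine ⟨ρ, (hH F hF).1, hρ, ?_⟩
      rcases hr : ρ.root with ⟨Γ, Δ⟩
      rw [ProofTree.concl, hr, Line.toSequent, Sequent.mk.injEq] at hc
      obtain ⟨hΓ, hΔ⟩ := hc
      rw [Multiset.coe_eq_zero] at hΓ
      simp only at hΓ hΔ
      rw [hΓ, hΔ]
    · exact ⟨[], fun h => absurd h hA⟩
  choose H hH using key
  have hρ : ∀ (A : FmL) (F : FmPlus), ∃ ρ, A ∈ C → F ∈ H A → Item.Valid C (F, ρ) := by
    intro A F
    by_cases h : A ∈ C ∧ F ∈ H A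
    · obtain ⟨ρ, hρ⟩ := (hH A h.1).1 F h.2
      exact ⟨ρ, fun _ _ => hρ⟩
    · exact ⟨.leaf ⟨[], none⟩, fun h₁ h₂ => absurd ⟨h₁, h₂⟩ h⟩
  choose ρ hρ using hρ
  refine ⟨H, hfin.toFinset.toList.flatMap fun A => (H A).map fun F => (A, F, ρ A F),
    fun A hA => (hH A hA).2, fun t ht => ?_, fun A hA F hF => ⟨ρ A F, ?_⟩⟩
  · simp only [List.mem_flatMap, List.mem_map, Finset.mem_toList, Set.Finite.mem_toFinset] at ht
    obtain ⟨A, hA, F, hF, rfl⟩ := ht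
    exact hρ A F hA hF
  · simp only [List.mem_flatMap, List.mem_map, Finset.mem_toList, Set.Finite.mem_toFinset]
    exact ⟨A, hA, F, hF, rfl⟩

end ModalHornTranslation

theorem mainTheorem3 (C : Set FmL) (hfin : C.Finite) (hC : ∀ A ∈ C, A.Constructive) :
    ∃ f : GProof C → List FmPlus × ProofTree ℕ,
      Nonempty (Turing.TM2ComputableInPolyTime encodeProof encodeOutput f) ∧
      ∀ π : GProof C,
        Provable C
          (⟨((f π).1 : Multiset FmPlus) + π.1.concl.ant.map transl,
            π.1.concl.suc.map transl⟩ : Sequent (ℕ ⊕ FmL)) ∧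
        (∀ F ∈ (f π).1, F.ModalHorn ∧ FromAngledAtoms F) ∧
        (f π).2.IsProof C ∧
        (f π).2.concl = ⟨0, some (Fm.conj ((f π).1.map stdSubst))⟩ := by
  obtain ⟨H, L, hH, hL, hHL⟩ := exists_templates hfin hC
  exact ⟨fun π => output L π.1, computable_output C L, fun π => output_spec hH hL hHL π.2⟩
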